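/- There are a real-RAM program $P$ and an absolute constant $C\in\mathbb N$ such that the following holds. Let $d,q,n$ be positive integers with $2d\mid q$ and $q\le n$, and let $f\in\mathbb R[x_1,\dots,x_n]$ be homogeneous of degree $d$ with exactly $m$ monomials (with non-zero coefficients). Given $n,d,q$ and the list of the monomials of $f$ with their coefficients, $P$ halts after at most $n^{Cq}$ steps and outputs $x\in\mathbb R^n$ with $\|x\|_2=1$ and $$\max_{\|y\|_2=1}|f(y)|\;\le\;\mathrm{SoS}_q(f)\;\le\;C^{d}\,\max\{1,m/q\}^{1/2}\,|f(x)| .$$ In particular, for $m\ge q$ the approximation factor is $2^{O(d)}(m/q)^{1/2}$. Here $\mathrm{SoS}_q(f)=\bigl(\sup_{\widetilde{\mathbb E}}\widetilde{\mathbb E}[f^{q/d}]\bigr)^{d/q}$ is the optimum of the level-$q$ sum-of-squares relaxation, the supremum being over all degree-$q$ pseudo-expectations on the sphere, i.e. linear functionals $\widetilde{\mathbb E}$ on the real polynomials in $x_1,\dots,x_n$ with $\widetilde{\mathbb E}[1]=1$, $\widetilde{\mathbb E}[p^2]\ge 0$ whenever $\deg p\le q/2$, and $\widetilde{\mathbb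 E}[(\|x\|_2^2-1)p]=0$ whenever $\deg p\le q-2$. A real RAM has cells for natural numbers and for real numbers, with indirect addressing by natural numbers; at unit cost it can add, subtract (truncated at $0$) and compare natural numbers, convert them to reals, and perform $+,-,\times,\div,\sqrt{\cdot}$ and exact comparison on reals; the constants in its program are natural numbers. The same program $P$ works for all $n,d,q,m,f$. -/

import Mathlib

open scoped ENNReal

/-! ### A real RAM

Programs of a small imperative language over two kinds of memory cells: cells holding natural
numbers (used for indices and counters) and cells holding real numbers.  Cells are organised in
arrays; the array is fixed by the program text, the index inside it is computed at run time.
The available operations are the usual ones of a real RAM: addition, subtraction and comparison of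
natural numbers; `+`, `-`, `*`, `/`, square root and exact comparison of reals; conversion of a
natural number to a real.  The only constants are natural numbers.  There is no rounding. -/

namespace RealRAM

/-- Memory: `nat a i` and `real a i` are the `i`-th cells of the `a`-th arrays. -/
structure State where
  nat : ℕ → ℕ → ℕ
  real : ℕ → ℕ → ℝ

/-- Natural-number expressions (`sub` is truncated subtraction). -/
inductive NExp where
  | const (c : ℕ)
  | get (a : ℕ) (i : NExp)
  | add (e₁ e₂ : NExp)
  | sub (e₁ e₂ : NExp)

/-- Real expressions. -/
inductive RExp where
  | cast (e : NExp)
  | get (a : ℕ) (i : NExp)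
  | add (e₁ e₂ : RExp)
  | sub (e₁ e₂ : RExp)
  | mul (e₁ e₂ : RExp)
  | div (e₁ e₂ : RExp)
  | sqrt (e : RExp)

/-- Tests. -/
inductive BExp where
  | natLt (e₁ e₂ : NExp)
  | realLt (e₁ e₂ : RExp)
  | not (b : BExp)
  | and (b₁ b₂ : BExp)

/-- Programs. -/
inductive Prog where
  | skip
  | setNat (a : ℕ) (i e : NExp)
  | setReal (a : ℕ) (i : NExp) (e : RExp)
  | seq (p₁ p₂ : Prog)
  | ite (b : BExp) (p₁ p₂ : Prog)
  | while (b : BExp) (p : Prog)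

def NExp.eval (s : State) : NExp → ℕ
  | const c => c
  | get a i => s.nat a (i.eval s)
  | add e₁ e₂ => e₁.eval s + e₂.eval s
  | sub e₁ e₂ => e₁.eval s - e₂.eval s

noncomputable def RExp.eval (s : State) : RExp → ℝ
  | cast e => (e.eval s : ℝ)
  | get a i => s.real a (i.eval s)
  | add e₁ e₂ => e₁.eval s + e₂.eval s
  | sub e₁ e₂ => e₁.eval s - e₂.eval s
  | mul e₁ e₂ => e₁.eval s * e₂.eval s
  | div e₁ e₂ => e₁.eval s / e₂.eval s
  | sqrt e => Real.sqrt (e.eval s)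

def BExp.holds (s : State) : BExp → Prop
  | natLt e₁ e₂ => e₁.eval s < e₂.eval s
  | realLt e₁ e₂ => e₁.eval s < e₂.eval s
  | not b => ¬ b.holds s
  | and b₁ b₂ => b₁.holds s ∧ b₂.holds s

def State.setNat (s : State) (a i v : ℕ) : State where
  nat := Function.update s.nat a (Function.update (s.nat a) i v)
  real := s.real

def State.setReal (s : State) (a i : ℕ) (v : ℝ) : State where
  nat := s.nat
  real := Function.update s.real a (Function.update (s.real a) i v)

/-- `Runs p s s' t`: started in state `s`, the program `p` halts in state `s'` after exactly `t`
steps.  Every assignment, every `skip` and every evaluation of a test is one step; since the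
expressions of a program have a fixed size, this is the number of elementary operations up to a
constant factor depending on the program only. -/
inductive Runs : Prog → State → State → ℕ → Prop where
  | skip (s : State) : Runs .skip s s 1
  | setNat (s : State) (a : ℕ) (i e : NExp) :
      Runs (.setNat a i e) s (s.setNat a (i.eval s) (e.eval s)) 1
  | setReal (s : State) (a : ℕ) (i : NExp) (e : RExp) :
      Runs (.setReal a i e) s (s.setReal a (i.eval s) (e.eval s)) 1
  | seq {p₁ p₂ : Prog} {s s' s'' : State} {t₁ t₂ : ℕ}
      (h₁ : Runs p₁ s s' t₁) (h₂ : Runs p₂ s' s'' t₂) : Runs (.seq p₁ p₂) s s'' (t₁ + t₂)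
  | iteTrue {b : BExp} {p₁ p₂ : Prog} {s s' : State} {t : ℕ}
      (hb : b.holds s) (h : Runs p₁ s s' t) : Runs (.ite b p₁ p₂) s s' (t + 1)
  | iteFalse {b : BExp} {p₁ p₂ : Prog} {s s' : State} {t : ℕ}
      (hb : ¬ b.holds s) (h : Runs p₂ s s' t) : Runs (.ite b p₁ p₂) s s' (t + 1)
  | whileTrue {b : BExp} {p : Prog} {s s' s'' : State} {t₁ t₂ : ℕ}
      (hb : b.holds s) (h₁ : Runs p s s' t₁) (h₂ : Runs (.while b p) s' s'' t₂) :
      Runs (.while b p) s s'' (t₁ + t₂ + 1)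
  | whileFalse {b : BExp} {p : Prog} {s : State} (hb : ¬ b.holds s) : Runs (.while b p) s s 1

end RealRAM

/-! ### Polynomial optimization over the sphere and its sum-of-squares relaxation -/

namespace SphereOpt

/-- A pseudo-expectation of degree `q` on `ℝⁿ` satisfying the constraint `‖x‖₂² = 1`: a linear
functional that is normalized, non-negative on squares of polynomials of degree at most `q / 2`,
and vanishes on the multiples of degree at most `q` of `‖x‖₂² - 1`.  (Only its values on
polynomials of degree at most `q` matter; every linear functional on those extends.) -/
structure PseudoExpectation (n q : ℕ) where
  toLin : MvPolynomial (Fin n) ℝ →ₗ[ℝ] ℝ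
  map_one : toLin 1 = 1
  sq_nonneg : ∀ p : MvPolynomial (Fin n) ℝ, 2 * p.totalDegree ≤ q → 0 ≤ toLin (p ^ 2)
  sphere : ∀ p : MvPolynomial (Fin n) ℝ, p.totalDegree + 2 ≤ q →
    toLin (((∑ i, MvPolynomial.X i ^ 2) - 1) * p) = 0

/-- `sup |f(x)|` over the Euclidean unit sphere. -/
noncomputable def sphereMax {n : ℕ} (f : MvPolynomial (Fin n) ℝ) : ℝ≥0∞ :=
  ⨆ x : {x : Fin n → ℝ // ∑ i, x i ^ 2 = 1}, ENNReal.ofReal |MvPolynomial.eval x.1 f|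

/-- The optimum of the level-`q` sum-of-squares relaxation of `sup |f(x)|` over the unit sphere, for
`f` homogeneous of degree `d` and `2d ∣ q`: the `d / q`-th power of the supremum of `E (f ^ (q / d))`
over the degree-`q` pseudo-expectations `E` on the sphere.  As `q / d` is even, each of these
numbers is non-negative. -/
noncomputable def sosMax {n : ℕ} (d q : ℕ) (f : MvPolynomial (Fin n) ℝ) : ℝ≥0∞ :=
  (⨆ E : PseudoExpectation n q, ENNReal.ofReal (E.toLin (f ^ (q / d)))) ^ ((d : ℝ) / (q : ℝ))

/-- The initial memory on input `(n, d, q, f)`, where `f` is presented as the list `L` of its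
monomials with their coefficients.  Natural-number array `0` starts with `n, d, q, m`, where `m` is
the number of monomials; natural-number array `1` holds the exponent vectors, one after the other,
the exponent of the `i`-th variable in the `j`-th monomial being in cell `j * n + i`; real array `0`
holds the coefficients.  All other cells are `0`. -/
noncomputable def inputState {n : ℕ} (d q : ℕ) (f : MvPolynomial (Fin n) ℝ)
    (L : List (Fin n →₀ ℕ)) : RealRAM.State where
  nat := fun a k =>
    if a = 0 then [n, d, q, L.length].getD k 0
    else if a = 1 then
      if h : 0 < n then L.getD (k / n) 0 ⟨k % n, Nat.mod_lt k h⟩ else 0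
    else 0
  real := fun a j => if a = 0 then (L.map fun μ => f.coeff μ).getD j 0 else 0

/-- The output: the first `n` cells of real array `1`. -/
def output (n : ℕ) (s : RealRAM.State) : Fin n → ℝ := fun i => s.real 1 i

end SphereOpt

namespace SphereOpt

open MvPolynomial Finset

/-! ### Bounding pseudo-expectations -/

namespace PseudoExpectation

variable {n q : ℕ} (E : PseudoExpectation n q)

/-! Write `q = 2 * d * r` and `h = d * r`, so that the relaxation maximizes `E[(f ^ r) ^ 2]`. For a
form `p` of degree `h`, positivity on squares alone gives `E[p ^ 2] ≤ ∑ p_γ ^ 2 / multinomial(γ)`,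
the squared Bombieri norm (`PseudoExpectation.map_sq_le`). It remains to bound the number and the
size of the coefficients of `f ^ r`.

The number is at most that of multisets of size `r` from `m` terms, hence at most `(e (1 + m / r)) ^
r` (`card_support_pow_le`, `multichoose_le`). The coefficient at `γ` is, up to a known factor, a
mixed finite difference of `f ^ r` over the grid `s_i β_i`, `0 ≤ β ≤ γ` (`sum_alternating_eval`).
With `s_i = γ_i ^ (-1/2)` the grid lies in the ball of radius `√h`. If `|f| ≤ V` at all normalized
grid points, then `k ^ k ≤ e ^ k k!` shows that every term of the Bombieri norm is at most `(4 e ^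
2) ^ h V ^ (2 r)` (`coeff_pow_sq_div_multinomial_le`). Multiplying and taking roots gives a bound
`16 ^ d √(max 1 (m / q)) V` (`sosMax_le`).

The algorithm is a brute-force search over these grid points. They are given by pairs `b ≤ g` with
`∑ g_i = h`, which are letter counts of words of length `h` over `2 n` letters
(`exists_candidate_eq`). So there are at most `(2 n) ^ h ≤ n ^ q` of them, and the best one found
attains a value that can serve as `V` (`search_halts`). -/

lemma map_normSq_pow (h : ℕ) (hq : 2 * h ≤ q) :
    E.toLin ((∑ i, X i ^ 2) ^ h) = 1 := by
  induction h with
  | zero => simpa using E.map_one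
  | succ h ih =>
    have hdeg : ((∑ i, X i ^ 2 : MvPolynomial (Fin n) ℝ) ^ h).totalDegree + 2 ≤ q := by
      have h2 : (∑ i, X i ^ 2 : MvPolynomial (Fin n) ℝ).IsHomogeneous 2 :=
        IsHomogeneous.sum _ _ _ fun i _ => isHomogeneous_X_pow i 2
      have := (h2.pow h).totalDegree_le
      omega
    have := E.sphere _ hdeg
    rw [sub_mul, map_sub, one_mul, ih (by omega), ← pow_succ'] at this
    linarith

/-- Applying `E` to the multinomial expansion of `‖x‖ ^ (2 h)` gives total mass 1. Every term is a
nonnegative multiple of `E` of a square, so terms outside `T` may be dropped. -/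
lemma sum_multinomial_mul_le_one (h : ℕ) (hq : 2 * h ≤ q) (T : Finset (Fin n →₀ ℕ))
    (hT : ∀ γ ∈ T, γ.degree = h) :
    ∑ γ ∈ T, (Nat.multinomial univ γ : ℝ) * E.toLin (monomial γ 1 ^ 2) ≤ 1 := by
  have key : ∀ k : Fin n →₀ ℕ,
      E.toLin ((Nat.multinomial univ k : MvPolynomial (Fin n) ℝ) * ∏ i, (X i ^ 2) ^ k i) =
        (Nat.multinomial univ k : ℝ) * E.toLin (monomial k 1 ^ 2) := by
    intro k
    rw [← nsmul_eq_mul, map_nsmul, nsmul_eq_mul]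
    congr 2
    rw [monomial_eq, C_1, one_mul, Finsupp.prod_fintype _ _ (by simp), ← prod_pow]
    exact prod_congr rfl fun i _ => by ring
  obtain ⟨G, hG⟩ : ∃ G : (Fin n → ℕ) → ℝ, ∀ k, G k =
      E.toLin ((Nat.multinomial univ k : MvPolynomial (Fin n) ℝ) * ∏ i, (X i ^ 2) ^ k i) :=
    ⟨_, fun _ => rfl⟩
  have hGkey : ∀ γ : Fin n →₀ ℕ,
      G γ = (Nat.multinomial univ γ : ℝ) * E.toLin (monomial γ 1 ^ 2) :=
    fun γ => (hG γ).trans (key γ)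
  have hone : ∑ k ∈ piAntidiag univ h, G k = 1 := by
    rw [← E.map_normSq_pow h hq, sum_pow_eq_sum_piAntidiag, map_sum]
    exact sum_congr rfl fun k _ => hG k
  refine le_trans ?_ hone.le
  rw [← sum_congr rfl fun γ _ => hGkey γ]
  refine (sum_map T ⟨fun γ : Fin n →₀ ℕ => (γ : Fin n → ℕ), DFunLike.coe_injective⟩ G).ge.trans
    (sum_le_sum_of_subset_of_nonneg ?_ ?_)
  · intro k hk
    obtain ⟨γ, hγ, rfl⟩ := mem_map.1 hk
    rw [mem_piAntidiag]
    refine ⟨?_, fun i _ => mem_univ i⟩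
    simpa [Finsupp.degree_eq_sum] using hT γ hγ
  · intro k hk _
    obtain ⟨γ, rfl⟩ : ∃ γ : Fin n →₀ ℕ, k = γ := ⟨Finsupp.equivFunOnFinite.symm k, by simp⟩
    rw [mem_piAntidiag] at hk
    rw [hGkey]
    refine mul_nonneg (Nat.cast_nonneg _) (E.sq_nonneg _ ?_)
    have h1 := (isHomogeneous_monomial (d := γ) (1 : ℝ) rfl).totalDegree_le
    have h2 : γ.degree = h := by simpa [Finsupp.degree_eq_sum] using hk.1
    omega

/-- The pseudo-expectation of the square of a form is at most its squared Bombieri norm. -/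
lemma map_sq_le (h : ℕ) (hq : 2 * h ≤ q) (p : MvPolynomial (Fin n) ℝ) (hp : p.IsHomogeneous h) :
    E.toLin (p ^ 2) ≤ ∑ γ ∈ p.support, p.coeff γ ^ 2 / (Nat.multinomial univ γ : ℝ) := by
  set A := ∑ γ ∈ p.support, p.coeff γ ^ 2 / (Nat.multinomial univ γ : ℝ) with hA
  have hw : ∀ γ : Fin n →₀ ℕ, (0 : ℝ) < Nat.multinomial univ γ := fun γ =>
    Nat.cast_pos.2 (Nat.multinomial_pos _ _)
  have hdeg : ∀ γ ∈ p.support, γ.degree = h := fun γ hγ => by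
    by_contra hne
    exact (mem_support_iff.1 hγ) (hp.coeff_eq_zero hne)
  have hsum := E.sum_multinomial_mul_le_one h hq p.support hdeg
  have hlin : ∑ γ ∈ p.support, p.coeff γ * E.toLin (monomial γ 1 * p) = E.toLin (p ^ 2) := by
    rw [pow_two]
    conv_rhs => rw [show p * p = (∑ γ ∈ p.support, monomial γ (p.coeff γ)) * p by rw [← as_sum p]]
    rw [sum_mul, map_sum]
    refine sum_congr rfl fun γ _ => ?_
    rw [← smul_eq_mul, ← map_smul, ← smul_mul_assoc, smul_monomial, smul_eq_mul, mul_one]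
  -- Apply `E` to the squares `(x ^ γ - c_γ p) ^ 2` with `c_γ = t p_γ / multinomial(γ)`, weight by
  -- the multinomials and sum: the cross terms reassemble into `E[p ^ 2]`, and the first terms
  -- contribute at most 1.
  have hsq : ∀ t : ℝ, 0 ≤ 1 - 2 * t * E.toLin (p ^ 2) + t ^ 2 * A * E.toLin (p ^ 2) := by
    intro t
    have h1 : ∀ γ ∈ p.support, 0 ≤ (Nat.multinomial univ γ : ℝ) * E.toLin (monomial γ 1 ^ 2)
        - 2 * t * (p.coeff γ * E.toLin (monomial γ 1 * p))
        + t ^ 2 * (p.coeff γ ^ 2 / (Nat.multinomial univ γ : ℝ)) * E.toLin (p ^ 2) := by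
      intro γ hγ
      set c := t * p.coeff γ / (Nat.multinomial univ γ : ℝ) with hc
      have hpos := E.sq_nonneg (monomial γ 1 - c • p) (by
        have h1 := (isHomogeneous_monomial (d := γ) (1 : ℝ) (hdeg γ hγ))
        have h2 := (h1.sub ((homogeneousSubmodule (Fin n) ℝ h).smul_mem c hp)).totalDegree_le
        omega)
      have hexp : (monomial γ 1 - c • p) ^ 2 =
          monomial γ 1 ^ 2 - (2 * c) • (monomial γ 1 * p) + (c ^ 2) • p ^ 2 := by
        simp only [smul_eq_C_mul, map_mul, map_pow, map_ofNat]; ring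
      rw [hexp, map_add, map_sub, map_smul, map_smul, smul_eq_mul, smul_eq_mul] at hpos
      have := mul_nonneg (hw γ).le hpos
      have hw' := (hw γ).ne'
      have he : (Nat.multinomial univ γ : ℝ) * c = t * p.coeff γ := by rw [hc]; field_simp
      have he2 : (Nat.multinomial univ γ : ℝ) * c ^ 2 =
          t ^ 2 * (p.coeff γ ^ 2 / (Nat.multinomial univ γ : ℝ)) := by
        rw [hc]; field_simp
      rw [← he2]
      linear_combination this - 2 * E.toLin (monomial γ 1 * p) * he
    have h2 := sum_nonneg h1
    rw [sum_add_distrib, sum_sub_distrib, ← mul_sum, hlin, ← sum_mul, ← mul_sum, ← hA] at h2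
    linarith
  have hA0 : 0 ≤ A := sum_nonneg fun γ _ => div_nonneg (_root_.sq_nonneg _) (hw γ).le
  rcases hA0.eq_or_lt with h0 | h0
  · have hp0 : p = 0 := by
      rw [← support_eq_empty]
      by_contra hne
      obtain ⟨γ, hγ⟩ := nonempty_iff_ne_empty.2 hne
      have := (sum_eq_zero_iff_of_nonneg fun γ _ => div_nonneg (_root_.sq_nonneg _) (hw γ).le).1
        (hA.symm.trans h0.symm) γ hγ
      rw [div_eq_zero_iff] at this
      exact this.elim (pow_ne_zero 2 (mem_support_iff.1 hγ)) (hw γ).ne'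
    simp [hp0, ← h0]
  -- The value `t = 1 / A` minimizes the quadratic and leaves `1 - E[p ^ 2] / A ≥ 0`.
  · have := hsq A⁻¹
    have h3 : A⁻¹ ^ 2 * A = A⁻¹ := by field_simp
    rw [h3] at this
    have h4 : A⁻¹ * E.toLin (p ^ 2) ≤ 1 := by linarith
    rwa [inv_mul_le_iff₀ h0, mul_one] at h4

end PseudoExpectation

/-- Point evaluation as a pseudo-expectation. -/
noncomputable def PseudoExpectation.ofPoint {n : ℕ} (q : ℕ) (x : Fin n → ℝ)
    (hx : ∑ i, x i ^ 2 = 1) : PseudoExpectation n q where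
  toLin := (aeval x).toLinearMap
  map_one := by simp
  sq_nonneg p _ := by
    simp only [AlgHom.toLinearMap_apply, map_pow]
    exact _root_.sq_nonneg _
  sphere p _ := by simp [hx]

/-- Point evaluations are feasible for the relaxation; since `q / d` is even, the power of `f` is
the power of `|f|`. -/
lemma sphereMax_le_sosMax {n d q : ℕ} (hd : 0 < d) (hq : 0 < q) (hdq : d ∣ q)
    (f : MvPolynomial (Fin n) ℝ) (heven : Even (q / d)) : sphereMax f ≤ sosMax d q f := by
  refine iSup_le fun x => ?_
  have h1 : ENNReal.ofReal (eval x.1 f ^ (q / d)) ≤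
      ⨆ E : PseudoExpectation n q, ENNReal.ofReal (E.toLin (f ^ (q / d))) := by
    refine le_iSup_of_le (PseudoExpectation.ofPoint q x.1 x.2) ?_
    simp [PseudoExpectation.ofPoint, aeval_eq_eval]
  refine le_trans ?_ (ENNReal.rpow_le_rpow h1 (by positivity))
  rw [← heven.pow_abs, ENNReal.ofReal_pow (abs_nonneg _), ← ENNReal.rpow_natCast,
    ← ENNReal.rpow_mul, Nat.cast_div hdq (by positivity)]
  have : (q : ℝ) / d * (d / q) = 1 := by field_simp
  rw [this, ENNReal.rpow_one]

/-! ### Coefficient extraction by finite differences -/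

/-- This is the `k`-th forward difference of `x ^ j` at 0, with step 1. -/
lemma sum_neg_one_pow_choose_mul_pow (k j : ℕ) (hj : j ≤ k) :
    ∑ b ∈ range (k + 1), ((-1 : ℝ) ^ (k - b) * k.choose b) * (b : ℝ) ^ j =
      if j = k then (k.factorial : ℝ) else 0 := by
  have h1 := fwdDiff_iter_eq_sum_shift (1 : ℝ) (fun x : ℝ => x ^ j) k 0
  have h2 : (fwdDiff (1 : ℝ))^[k] (fun x : ℝ => x ^ j) 0 =
      if j = k then (k.factorial : ℝ) else 0 := by
    split_ifs with h
    · subst h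
      rw [fwdDiff_iter_eq_factorial]
      simp
    · rw [fwdDiff_iter_pow_eq_zero_of_lt (lt_of_le_of_ne hj h)]
      rfl
  rw [← h2, h1]
  refine sum_congr rfl fun b _ => ?_
  simp [zsmul_eq_mul]

/-- Taking a difference of order `γ i` in each variable kills every monomial `δ` with `δ i < γ i`
for some `i`. As `δ` and `γ` have the same degree, only `δ = γ` survives. -/
lemma sum_alternating_eval {n : ℕ} {h : ℕ} (p : MvPolynomial (Fin n) ℝ) (hp : p.IsHomogeneous h)
    (γ : Fin n →₀ ℕ) (hγ : γ.degree = h) (s : Fin n → ℝ) :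
    ∑ β ∈ Fintype.piFinset fun i => range (γ i + 1),
      (∏ i, ((-1 : ℝ) ^ (γ i - β i) * (γ i).choose (β i))) * eval (fun i => s i * β i) p =
    p.coeff γ * ∏ i, ((γ i).factorial * s i ^ γ i) := by
  simp_rw [eval_eq', mul_sum]
  rw [sum_comm]
  have hmon : ∀ δ : Fin n →₀ ℕ, δ.degree = h →
      ∑ β ∈ Fintype.piFinset fun i => range (γ i + 1),
        (∏ i, ((-1 : ℝ) ^ (γ i - β i) * (γ i).choose (β i))) *
          (p.coeff δ * ∏ i, (s i * β i) ^ δ i) =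
      if δ = γ then p.coeff γ * ∏ i, ((γ i).factorial * s i ^ γ i) else 0 := by
    intro δ hδ
    have h1 : ∑ β ∈ Fintype.piFinset fun i => range (γ i + 1),
        (∏ i, ((-1 : ℝ) ^ (γ i - β i) * (γ i).choose (β i))) *
          (p.coeff δ * ∏ i, (s i * β i) ^ δ i) =
        p.coeff δ * ∏ i, (s i ^ δ i * ∑ b ∈ range (γ i + 1),
          ((-1 : ℝ) ^ (γ i - b) * (γ i).choose b) * (b : ℝ) ^ δ i) := by
      simp_rw [mul_sum]
      rw [prod_univ_sum, mul_sum]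
      refine sum_congr rfl fun β _ => ?_
      rw [mul_left_comm, ← prod_mul_distrib]
      congr 1
      exact prod_congr rfl fun i _ => by rw [mul_pow]; ring
    rw [h1]
    split_ifs with h2
    · subst h2
      congr 1
      refine prod_congr rfl fun i _ => ?_
      rw [sum_neg_one_pow_choose_mul_pow _ _ le_rfl, if_pos rfl, mul_comm]
    · obtain ⟨i, hi⟩ : ∃ i, δ i < γ i := by
        by_contra! hle
        refine h2 (DFunLike.coe_injective (funext fun i => ?_))
        rw [Finsupp.degree_eq_sum] at hγ hδ
        exact (((sum_eq_sum_iff_of_le fun i _ => hle i).1 (hγ.trans hδ.symm)) i (mem_univ i)).symm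
      rw [prod_eq_zero (mem_univ i), mul_zero]
      rw [sum_neg_one_pow_choose_mul_pow _ _ hi.le, if_neg hi.ne, mul_zero]
  rw [sum_congr rfl fun δ hδ => hmon δ ?_]
  · rw [sum_ite_eq' p.support γ]
    split_ifs with h2
    · rfl
    · rw [notMem_support_iff.1 h2, zero_mul]
  · by_contra hne
    exact (mem_support_iff.1 hδ) (hp.coeff_eq_zero hne)

/-- The absolute weights of the mixed difference are products of binomial coefficients, with total
`∏ 2 ^ γ i = 2 ^ h`. -/
lemma abs_coeff_mul_le {n : ℕ} {h : ℕ} (p : MvPolynomial (Fin n) ℝ) (hp : p.IsHomogeneous h)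
    (γ : Fin n →₀ ℕ) (hγ : γ.degree = h) (s : Fin n → ℝ) (hs : ∀ i, 0 ≤ s i) (M : ℝ)
    (hM : ∀ β : Fin n → ℕ, (∀ i, β i ≤ γ i) → |eval (fun i => s i * β i) p| ≤ M) :
    |p.coeff γ| * ∏ i, ((γ i).factorial * s i ^ γ i) ≤ 2 ^ h * M := by
  have h0 : 0 ≤ ∏ i, ((γ i).factorial * s i ^ γ i : ℝ) :=
    prod_nonneg fun i _ => mul_nonneg (Nat.cast_nonneg _) (pow_nonneg (hs i) _)
  rw [← abs_of_nonneg h0, ← abs_mul, ← sum_alternating_eval p hp γ hγ s]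
  refine (abs_sum_le_sum_abs _ _).trans ?_
  have h2 : (2 : ℝ) ^ h = ∑ β ∈ Fintype.piFinset fun i => range (γ i + 1),
      ∏ i, ((γ i).choose (β i) : ℝ) := by
    rw [← prod_univ_sum (fun i => range (γ i + 1)) (fun i b => ((γ i).choose b : ℝ)), ← hγ,
      Finsupp.degree_eq_sum, ← prod_pow_eq_pow_sum]
    refine prod_congr rfl fun i _ => ?_
    exact_mod_cast (Nat.sum_range_choose (γ i)).symm
  rw [h2, sum_mul]
  refine sum_le_sum fun β hβ => ?_
  rw [abs_mul, abs_prod]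
  refine mul_le_mul (le_of_eq ?_) (hM β fun i => ?_) (abs_nonneg _)
    (prod_nonneg fun i _ => Nat.cast_nonneg _)
  · refine prod_congr rfl fun i _ => ?_
    simp [abs_mul]
  · have := Fintype.mem_piFinset.1 hβ i
    rw [mem_range] at this
    omega

/-! ### Homogeneity, rescaling to the sphere and candidate directions -/

lemma eval_smul_of_isHomogeneous {n d : ℕ} {f : MvPolynomial (Fin n) ℝ} (hf : f.IsHomogeneous d)
    (c : ℝ) (x : Fin n → ℝ) : eval (fun i => c * x i) f = c ^ d * eval x f := by
  rw [eval_eq', eval_eq', mul_sum]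
  refine sum_congr rfl fun δ hδ => ?_
  have : δ.degree = d := by
    by_contra hne
    exact (mem_support_iff.1 hδ) (hf.coeff_eq_zero hne)
  simp_rw [mul_pow]
  rw [prod_mul_distrib, prod_pow_eq_pow_sum, ← Finsupp.degree_eq_sum, this]
  ring

/-- Rescaling to the unit sphere (the origin is left fixed). -/
noncomputable def normalize {n : ℕ} (x : Fin n → ℝ) : Fin n → ℝ :=
  fun i => x i / √(∑ j, x j * x j)

/-- The candidate direction with coordinates `b i / √(g i)`. -/
noncomputable def direction {n : ℕ} (b g : Fin n → ℕ) : Fin n → ℝ := fun i => b i / √(g i)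

lemma sum_normalize_sq {n : ℕ} (x : Fin n → ℝ) (hx : x ≠ 0) : ∑ i, normalize x i ^ 2 = 1 := by
  obtain ⟨i, hi⟩ := Function.ne_iff.1 hx
  have hpos : 0 < ∑ j, x j * x j :=
    sum_pos' (fun j _ => mul_self_nonneg _) ⟨i, mem_univ i, mul_self_pos.2 hi⟩
  simp_rw [normalize, div_pow, Real.sq_sqrt hpos.le, pow_two]
  rw [← sum_div, div_self hpos.ne']

lemma eval_eq_sqrt_pow_mul_eval_normalize {n d : ℕ} {f : MvPolynomial (Fin n) ℝ}
    (hf : f.IsHomogeneous d) (x : Fin n → ℝ) :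
    eval x f = √(∑ j, x j * x j) ^ d * eval (normalize x) f := by
  rw [← eval_smul_of_isHomogeneous hf]
  congr 2
  funext i
  rw [normalize]
  -- At the origin, division by zero makes `normalize x` zero too, so the identity needs no
  -- hypothesis `x ≠ 0`.
  by_cases h0 : √(∑ j, x j * x j) = 0
  · rw [h0, zero_mul]
    rw [Real.sqrt_eq_zero (sum_nonneg fun j _ => mul_self_nonneg _),
      sum_eq_zero_iff_of_nonneg fun j _ => mul_self_nonneg _] at h0
    exact mul_self_eq_zero.1 (h0 i (mem_univ i))
  · rw [mul_div_cancel₀ _ h0]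

/-- Each summand is `b i ^ 2 / g i ≤ g i`; if `g i = 0` the quotient is 0 by convention. -/
lemma sum_direction_sq_le {n : ℕ} (b g : Fin n → ℕ) (hbg : ∀ i, b i ≤ g i) :
    ∑ i, direction b g i * direction b g i ≤ ((∑ i, g i : ℕ) : ℝ) := by
  push_cast
  refine sum_le_sum fun i _ => ?_
  rw [direction, ← pow_two, div_pow, Real.sq_sqrt (Nat.cast_nonneg _)]
  refine div_le_of_le_mul₀ (Nat.cast_nonneg _) (Nat.cast_nonneg _) ?_
  rw [← pow_two]
  exact pow_le_pow_left₀ (Nat.cast_nonneg _) (Nat.cast_le.2 (hbg i)) 2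

/-- The coefficient bound: the Bombieri norm of each term of `f ^ r` is controlled by the largest
value of `f` at the normalized candidate directions. -/
lemma coeff_pow_sq_div_multinomial_le {n d r : ℕ} {f : MvPolynomial (Fin n) ℝ}
    (hf : f.IsHomogeneous d) (V : ℝ)
    (γ : Fin n →₀ ℕ) (hγ : γ.degree = d * r)
    (hV : ∀ b : Fin n → ℕ, (∀ i, b i ≤ γ i) → |eval (normalize (direction b γ)) f| ≤ V) :
    (f ^ r).coeff γ ^ 2 / (Nat.multinomial univ γ : ℝ) ≤
      (4 * Real.exp 2) ^ (d * r) * V ^ (2 * r) := by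
  set h := d * r with hh
  set a := (f ^ r).coeff γ
  have hV0 : 0 ≤ V := (abs_nonneg _).trans (hV 0 fun i => Nat.zero_le _)
  -- The scaling `1 / √(γ i)` turns the grid points into the directions `b i / √(γ i)` of norm at
  -- most `√h`. Where `γ i = 0` the scale is 0, harmlessly, since only its zeroth power enters.
  have h1 := abs_coeff_mul_le (f ^ r) (hf.pow r) γ hγ (fun i => 1 / √(γ i)) (fun i => by positivity)
    (√h ^ h * V ^ r) (by
      intro b hb
      have he : (fun i => 1 / √(γ i : ℝ) * (b i : ℝ)) = direction b γ := by
        funext i; rw [direction]; ring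
      rw [he, map_pow, eval_eq_sqrt_pow_mul_eval_normalize hf, mul_pow, ← pow_mul, abs_mul,
        abs_pow, abs_pow, ← hh, abs_of_nonneg (Real.sqrt_nonneg _)]
      refine mul_le_mul (pow_le_pow_left₀ (Real.sqrt_nonneg _) (Real.sqrt_le_sqrt ?_) _)
        (pow_le_pow_left₀ (abs_nonneg _) (hV b hb) _) (by positivity) (by positivity)
      refine (sum_direction_sq_le b γ hb).trans (le_of_eq ?_)
      rw [← Finsupp.degree_eq_sum, hγ])
  set F : ℝ := ∏ i, ((γ i).factorial : ℝ) with hF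
  set G : ℝ := ∏ i, (γ i : ℝ) ^ γ i with hG
  have hFpos : 0 < F := prod_pos fun i _ => Nat.cast_pos.2 (Nat.factorial_pos _)
  have hGpos : 0 < G := prod_pos fun i _ => by
    rcases Nat.eq_zero_or_pos (γ i) with h | h
    · simp [h]
    · positivity
  have hmult : F * (Nat.multinomial univ γ : ℝ) = (h.factorial : ℝ) := by
    have := Nat.multinomial_spec univ γ
    rw [← Finsupp.degree_eq_sum, hγ] at this
    rw [hF]
    exact_mod_cast this
  have hsq : a ^ 2 * (F ^ 2 / G) ≤ 4 ^ h * ((h : ℝ) ^ h * V ^ (2 * r)) := by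
    have h2 := pow_le_pow_left₀ (mul_nonneg (abs_nonneg _) (prod_nonneg fun i _ => by positivity))
      h1 2
    have e1 : (∏ i, ((γ i).factorial * (1 / √(γ i : ℝ)) ^ γ i : ℝ)) ^ 2 = F ^ 2 / G := by
      rw [hF, hG, ← prod_pow, ← prod_pow, ← prod_div_distrib]
      refine prod_congr rfl fun i _ => ?_
      rw [mul_pow, ← pow_mul, mul_comm (γ i) 2, pow_mul, div_pow, Real.sq_sqrt (Nat.cast_nonneg _),
        one_pow, div_pow, one_pow, mul_one_div]
    rw [mul_pow, sq_abs, e1] at h2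
    refine h2.trans (le_of_eq ?_)
    rw [mul_pow, mul_pow, ← pow_mul, mul_comm h 2, pow_mul, ← pow_mul (√(h : ℝ)), mul_comm h 2,
      pow_mul (√(h : ℝ)), Real.sq_sqrt (Nat.cast_nonneg _), ← pow_mul V, mul_comm r 2]
    norm_num
  -- Both this and `hhF` come from `k ^ k / k! ≤ e ^ k`, a single term of the exponential series;
  -- together they account for the factor `e ^ (2 h)`.
  have hGF : G ≤ Real.exp h * F := by
    have : Real.exp h = ∏ i, Real.exp (γ i) := by
      rw [← Real.exp_sum, ← hγ, Finsupp.degree_eq_sum]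
      push_cast; rfl
    rw [this, hG, hF, ← prod_mul_distrib]
    refine prod_le_prod (fun i _ => by positivity) fun i _ => ?_
    have := Real.pow_div_factorial_le_exp (γ i : ℝ) (Nat.cast_nonneg _) (γ i)
    rwa [div_le_iff₀ (Nat.cast_pos.2 (Nat.factorial_pos _))] at this
  have hhF : (h : ℝ) ^ h ≤ Real.exp h * h.factorial := by
    have := Real.pow_div_factorial_le_exp (h : ℝ) (Nat.cast_nonneg _) h
    rwa [div_le_iff₀ (Nat.cast_pos.2 (Nat.factorial_pos _))] at this
  have hexp : Real.exp 2 ^ h = Real.exp h * Real.exp h := by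
    rw [← Real.exp_nat_mul, ← Real.exp_add]; congr 1; ring
  have hmp : (0 : ℝ) < Nat.multinomial univ γ := Nat.cast_pos.2 (Nat.multinomial_pos _ _)
  have hhpos : (0 : ℝ) < h.factorial := Nat.cast_pos.2 (Nat.factorial_pos _)
  rw [div_le_iff₀ hmp, mul_pow, hexp]
  have h3 : a ^ 2 * F ^ 2 ≤ 4 ^ h * ((h : ℝ) ^ h * V ^ (2 * r)) * G := by
    rwa [mul_div_assoc', div_le_iff₀ hGpos] at hsq
  have h4 : a ^ 2 * F ^ 2 ≤
      4 ^ h * ((Real.exp h * h.factorial) * V ^ (2 * r)) * (Real.exp h * F) :=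
    h3.trans (by gcongr)
  rw [← hmult] at h4
  have h5 : a ^ 2 * F ^ 2 ≤ (4 ^ h * (Real.exp h * Real.exp h) * V ^ (2 * r) *
      (Nat.multinomial univ γ : ℝ)) * F ^ 2 := by
    refine h4.trans (le_of_eq ?_)
    ring
  exact le_of_mul_le_mul_right h5 (by positivity)

/-! ### The number of monomials of a power -/

/-- Expand the power by the multinomial theorem in the terms of `f`: each product of terms is a
single monomial, and the products are indexed by multisets of size `r`. -/
lemma card_support_pow_le {n : ℕ} (f : MvPolynomial (Fin n) ℝ) (r : ℕ) :
    (f ^ r).support.card ≤ (f.support.card).multichoose r := by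
  classical
  have h1 : f ^ r = ∑ k ∈ piAntidiag (univ : Finset f.support) r,
      (Nat.multinomial univ k : MvPolynomial (Fin n) ℝ) *
        ∏ i : f.support, (monomial i.1 (f.coeff i.1)) ^ k i := by
    rw [← sum_pow_eq_sum_piAntidiag]
    conv_lhs => rw [as_sum f, ← sum_coe_sort]
  rw [h1]
  refine (card_le_card support_sum).trans (card_biUnion_le.trans ?_)
  calc ∑ k ∈ piAntidiag (univ : Finset f.support) r, _ ≤
      ∑ k ∈ piAntidiag (univ : Finset f.support) r, 1 := by
        refine sum_le_sum fun k _ => ?_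
        obtain ⟨δ, c, hc⟩ : ∃ δ c, ∏ i : f.support, (monomial i.1 (f.coeff i.1)) ^ k i =
            monomial δ c := by
          refine prod_induction _ (fun p => ∃ δ c, p = monomial δ c) ?_ ⟨0, 1, rfl⟩ ?_
          · rintro _ _ ⟨δ, c, rfl⟩ ⟨δ', c', rfl⟩
            exact ⟨_, _, monomial_mul⟩
          · exact fun i _ => ⟨_, _, monomial_pow⟩
        rw [hc, ← map_natCast C, C_mul_monomial]
        exact (card_le_card support_monomial_subset).trans (by simp)
    _ = _ := by
        rw [sum_const, smul_eq_mul, mul_one, ← Fintype.card_coe f.support, ← card_univ,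
          ← card_finsuppAntidiag_nat_eq_multichoose]
        simp [finsuppAntidiag]

/-- Combine `choose N r ≤ N ^ r / r!` with `r ^ r / r! ≤ e ^ r`. -/
lemma multichoose_le (m r : ℕ) (hr : 0 < r) :
    (m.multichoose r : ℝ) ≤ (Real.exp 1 * (1 + m / r)) ^ r := by
  rw [Nat.multichoose_eq]
  refine (Nat.choose_le_pow_div r (m + r - 1)).trans ?_
  have h1 := Real.pow_div_factorial_le_exp (r : ℝ) (Nat.cast_nonneg _) r
  have hr' : (0 : ℝ) < r := Nat.cast_pos.2 hr
  have h2 : (((m + r - 1 : ℕ) : ℝ)) ^ r ≤ (r * (1 + m / r) : ℝ) ^ r := by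
    refine pow_le_pow_left₀ (Nat.cast_nonneg _) ?_ r
    rw [mul_add, mul_div_cancel₀ _ hr'.ne', mul_one]
    exact_mod_cast (by omega : m + r - 1 ≤ r + m)
  calc (((m + r - 1 : ℕ) : ℝ)) ^ r / r.factorial ≤ (r * (1 + m / r) : ℝ) ^ r / r.factorial := by
        gcongr
    _ = (r : ℝ) ^ r / r.factorial * (1 + m / r) ^ r := by rw [mul_pow]; ring
    _ ≤ Real.exp r * (1 + m / r) ^ r := by gcongr
    _ = _ := by rw [mul_pow, ← Real.exp_nat_mul, mul_one]

/-! ### The upper bound on the relaxation -/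

lemma sosMax_le {n d q r : ℕ} (hd : 0 < d) (hr : 0 < r) (hq : q = 2 * d * r)
    (f : MvPolynomial (Fin n) ℝ) (hf : f.IsHomogeneous d) (V : ℝ) (hV0 : 0 ≤ V)
    (hV : ∀ g b : Fin n → ℕ, ∑ i, g i = d * r → (∀ i, b i ≤ g i) →
      |eval (normalize (direction b g)) f| ≤ V) (C : ℝ) (hC : 16 ≤ C) :
    sosMax d q f ≤ ENNReal.ofReal (C ^ d * √(max 1 ((f.support.card : ℝ) / q)) * V) := by
  set M : ℝ := max 1 ((f.support.card : ℝ) / q) with hM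
  have hM1 : 1 ≤ M := le_max_left _ _
  have hr0 : (0 : ℝ) < r := by exact_mod_cast hr
  have hqd : q / d = r * 2 := by
    rw [hq, show 2 * d * r = d * (r * 2) by ring, Nat.mul_div_cancel_left _ hd]
  have he3 : Real.exp 1 ^ 3 ≤ 21 := by
    have := Real.exp_one_lt_d9
    calc Real.exp 1 ^ 3 ≤ 2.75 ^ 3 := by gcongr; linarith
      _ ≤ 21 := by norm_num
  -- The left side is the `r`-th root of the bound on `E[f ^ (2 r)]`. Since `m / r = 2 d (m / q)`,
  -- Bernoulli's inequality `1 + 2 d ≤ 3 ^ d` absorbs the factor `d`. The constant works because `12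
  -- e ^ 3 ≤ 252 ≤ 16 ^ 2`.
  have hbase : Real.exp 1 * (1 + f.support.card / r) * (4 * Real.exp 2) ^ d * V ^ 2 ≤
      (C ^ d * √M * V) ^ 2 := by
    have h1 : 1 + (f.support.card : ℝ) / r ≤ 3 ^ d * M := by
      have h2 : (f.support.card : ℝ) / r = 2 * d * (f.support.card / q) := by
        rw [hq]; push_cast; field_simp
      have h3 : 1 + (d : ℝ) * 2 ≤ (1 + 2) ^ d := one_add_mul_le_pow (by norm_num) d
      calc 1 + (f.support.card : ℝ) / r ≤ M + 2 * d * M := by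
            rw [h2]
            have : (f.support.card : ℝ) / q ≤ M := le_max_right _ _
            gcongr
        _ = (1 + d * 2) * M := by ring
        _ ≤ (1 + 2) ^ d * M := by gcongr
        _ = _ := by norm_num
    have h4 : Real.exp 1 ≤ Real.exp 1 ^ d := le_self_pow₀ (Real.one_le_exp (by norm_num)) hd.ne'
    have h5 : Real.exp 2 = Real.exp 1 ^ 2 := by rw [← Real.exp_nat_mul]; norm_num
    calc Real.exp 1 * (1 + f.support.card / r) * (4 * Real.exp 2) ^ d * V ^ 2
        ≤ Real.exp 1 ^ d * (3 ^ d * M) * (4 * Real.exp 2) ^ d * V ^ 2 := by gcongr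
      _ = (12 * Real.exp 1 ^ 3) ^ d * M * V ^ 2 := by
          rw [h5, show (12 : ℝ) * Real.exp 1 ^ 3 = Real.exp 1 * 3 * (4 * Real.exp 1 ^ 2) by ring,
            mul_pow]
          simp only [mul_pow]
          ring
      _ ≤ (C ^ 2) ^ d * M * V ^ 2 := by
          have : 12 * Real.exp 1 ^ 3 ≤ C ^ 2 := by nlinarith
          gcongr
      _ = _ := by
          rw [mul_pow, mul_pow, Real.sq_sqrt (by linarith)]; ring
  have hE : ∀ E : PseudoExpectation n q,
      E.toLin (f ^ (q / d)) ≤ (C ^ d * √M * V) ^ (2 * r) := by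
    intro E
    have h1 := E.map_sq_le (d * r) (by rw [hq, mul_assoc]) (f ^ r) (hf.pow r)
    rw [← pow_mul, ← hqd] at h1
    refine h1.trans ?_
    calc ∑ γ ∈ (f ^ r).support, (f ^ r).coeff γ ^ 2 / (Nat.multinomial univ γ : ℝ)
        ≤ ∑ γ ∈ (f ^ r).support, (4 * Real.exp 2) ^ (d * r) * V ^ (2 * r) := by
          refine sum_le_sum fun γ hγ => ?_
          have hdeg : γ.degree = d * r := by
            by_contra hne
            exact (mem_support_iff.1 hγ) ((hf.pow r).coeff_eq_zero hne)
          refine coeff_pow_sq_div_multinomial_le hf V γ hdeg fun b hb => hV γ b ?_ hb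
          rw [← Finsupp.degree_eq_sum, hdeg]
      _ = ((f ^ r).support.card : ℝ) * ((4 * Real.exp 2) ^ (d * r) * V ^ (2 * r)) := by
          rw [sum_const, nsmul_eq_mul]
      _ ≤ (Real.exp 1 * (1 + f.support.card / r)) ^ r *
            ((4 * Real.exp 2) ^ (d * r) * V ^ (2 * r)) := by
          refine mul_le_mul_of_nonneg_right ?_ (by positivity)
          exact (Nat.cast_le.2 (card_support_pow_le f r)).trans (multichoose_le _ r hr)
      _ = (Real.exp 1 * (1 + f.support.card / r) * (4 * Real.exp 2) ^ d * V ^ 2) ^ r := by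
          rw [mul_pow _ (V ^ 2), mul_pow _ ((4 * Real.exp 2) ^ d), ← pow_mul, ← pow_mul, mul_assoc]
      _ ≤ ((C ^ d * √M * V) ^ 2) ^ r := by gcongr
      _ = _ := by rw [← pow_mul]
  have hnn : 0 ≤ C ^ d * √M * V := by positivity
  calc sosMax d q f ≤ ENNReal.ofReal ((C ^ d * √M * V) ^ (2 * r)) ^ ((d : ℝ) / (q : ℝ)) :=
        ENNReal.rpow_le_rpow (iSup_le fun E => ENNReal.ofReal_le_ofReal (hE E)) (by positivity)
    _ = _ := by
        rw [ENNReal.ofReal_pow hnn, ← ENNReal.rpow_natCast, ← ENNReal.rpow_mul]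
        have : ((2 * r : ℕ) : ℝ) * ((d : ℝ) / q) = 1 := by
          rw [hq]; push_cast; field_simp
        rw [this, ENNReal.rpow_one]

end SphereOpt

namespace RealRAM

/-! ### Program logic with time bounds -/

@[simp] lemma State.setNat_nat (s : State) (a i v a' i' : ℕ) :
    (s.setNat a i v).nat a' i' = if a' = a ∧ i' = i then v else s.nat a' i' := by
  by_cases h : a' = a
  · subst h
    by_cases h' : i' = i <;> simp [State.setNat, h']
  · simp [State.setNat, h]

@[simp] lemma State.setNat_real (s : State) (a i v : ℕ) : (s.setNat a i v).real = s.real := rfl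

@[simp] lemma State.setReal_nat (s : State) (a i : ℕ) (v : ℝ) :
    (s.setReal a i v).nat = s.nat := rfl

@[simp] lemma State.setReal_real (s : State) (a i : ℕ) (v : ℝ) (a' i' : ℕ) :
    (s.setReal a i v).real a' i' = if a' = a ∧ i' = i then v else s.real a' i' := by
  by_cases h : a' = a
  · subst h
    by_cases h' : i' = i <;> simp [State.setReal, h']
  · simp [State.setReal, h]

/-- Started in `s`, the program `p` halts within `T` steps in a state satisfying `Q`. -/
def Halts (p : Prog) (s : State) (T : ℕ) (Q : State → Prop) : Prop :=
  ∃ s' t, Runs p s s' t ∧ t ≤ T ∧ Q s'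

lemma Halts.mono {p : Prog} {s : State} {T T' : ℕ} {Q Q' : State → Prop} (h : Halts p s T Q)
    (hT : T ≤ T') (hQ : ∀ s', Q s' → Q' s') : Halts p s T' Q' := by
  obtain ⟨s', t, h1, h2, h3⟩ := h
  exact ⟨s', t, h1, h2.trans hT, hQ s' h3⟩

/-- The postcondition of the first program is itself a halting statement for the second, so proofs
follow the nesting of `Prog.seq`. -/
lemma Halts.seq {p₁ p₂ : Prog} {s : State} {T₁ T₂ : ℕ} {Q : State → Prop}
    (h : Halts p₁ s T₁ fun s' => Halts p₂ s' T₂ Q) : Halts (.seq p₁ p₂) s (T₁ + T₂) Q := by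
  obtain ⟨s', t, h1, h2, s'', t', h3, h4, h5⟩ := h
  exact ⟨s'', t + t', .seq h1 h3, by omega, h5⟩

lemma Halts.skip {s : State} {Q : State → Prop} (h : Q s) : Halts .skip s 1 Q :=
  ⟨_, _, .skip s, le_rfl, h⟩

lemma Halts.setNat {s : State} {a : ℕ} {i e : NExp} {Q : State → Prop}
    (h : Q (s.setNat a (i.eval s) (e.eval s))) : Halts (.setNat a i e) s 1 Q :=
  ⟨_, _, .setNat s a i e, le_rfl, h⟩

lemma Halts.setReal {s : State} {a : ℕ} {i : NExp} {e : RExp} {Q : State → Prop}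
    (h : Q (s.setReal a (i.eval s) (e.eval s))) : Halts (.setReal a i e) s 1 Q :=
  ⟨_, _, .setReal s a i e, le_rfl, h⟩

lemma Halts.ite {b : BExp} {p₁ p₂ : Prog} {s : State} {T : ℕ} {Q : State → Prop}
    (h₁ : b.holds s → Halts p₁ s T Q) (h₂ : ¬ b.holds s → Halts p₂ s T Q) :
    Halts (.ite b p₁ p₂) s (T + 1) Q := by
  by_cases hb : b.holds s
  · obtain ⟨s', t, h, ht, hQ⟩ := h₁ hb
    exact ⟨s', t + 1, .iteTrue hb h, by omega, hQ⟩
  · obtain ⟨s', t, h, ht, hQ⟩ := h₂ hb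
    exact ⟨s', t + 1, .iteFalse hb h, by omega, hQ⟩

/-- A loop with an invariant indexed by the number of completed iterations. -/
lemma Halts.loop {b : BExp} {p : Prog} (Inv : ℕ → State → Prop) (N T : ℕ)
    (hb : ∀ i s, i ≤ N → Inv i s → (b.holds s ↔ i < N))
    (hp : ∀ i s, i < N → Inv i s → Halts p s T (Inv (i + 1))) {s : State} (hs : Inv 0 s) :
    Halts (.while b p) s (N * (T + 1) + 1) (Inv N) := by
  have key : ∀ k i s, i + k = N → Inv i s →
      Halts (.while b p) s (k * (T + 1) + 1) (Inv N) := by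
    intro k
    induction k with
    | zero =>
      intro i s hi hs
      obtain rfl : i = N := by omega
      exact ⟨s, 1, .whileFalse (by rw [hb i s le_rfl hs]; omega), by omega, hs⟩
    | succ k ih =>
      intro i s hi hs
      obtain ⟨s', t, h1, h2, h3⟩ := hp i s (by omega) hs
      obtain ⟨s'', t', h4, h5, h6⟩ := ih (i + 1) s' (by omega) h3
      refine ⟨s'', t + t' + 1, .whileTrue ((hb i s (by omega) hs).2 (by omega)) h1 h4, ?_, h6⟩
      rw [Nat.succ_mul]
      omega
  exact key N 0 s (by omega) hs

/-- `s'` agrees with `s` on the first `c` arrays of natural numbers and the first `r` arrays of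
reals. -/
def Agree (c r : ℕ) (s s' : State) : Prop :=
  (∀ a < c, s'.nat a = s.nat a) ∧ ∀ a < r, s'.real a = s.real a

lemma Agree.refl (c r : ℕ) (s : State) : Agree c r s s := ⟨fun _ _ => rfl, fun _ _ => rfl⟩

lemma Agree.trans {c r : ℕ} {s s' s'' : State} (h : Agree c r s s') (h' : Agree c r s' s'') :
    Agree c r s s'' :=
  ⟨fun a ha => (h'.1 a ha).trans (h.1 a ha), fun a ha => (h'.2 a ha).trans (h.2 a ha)⟩

lemma Agree.mono {c r c' r' : ℕ} {s s' : State} (h : Agree c r s s') (hc : c' ≤ c) (hr : r' ≤ r) :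
    Agree c' r' s s' :=
  ⟨fun a ha => h.1 a (by omega), fun a ha => h.2 a (by omega)⟩

lemma Agree.setNat {c r : ℕ} {s s' : State} (h : Agree c r s s') {a : ℕ} (i v : ℕ) (ha : c ≤ a) :
    Agree c r s (s'.setNat a i v) := by
  refine ⟨fun b hb => ?_, h.2⟩
  rw [← h.1 b hb]
  funext j
  rw [State.setNat_nat, if_neg (by omega)]

lemma Agree.setReal {c r : ℕ} {s s' : State} (h : Agree c r s s') {a : ℕ} (i : ℕ) (v : ℝ)
    (ha : r ≤ a) : Agree c r s (s'.setReal a i v) := by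
  refine ⟨h.1, fun b hb => ?_⟩
  rw [← h.2 b hb]
  funext j
  rw [State.setReal_real, if_neg (by omega)]

end RealRAM

namespace SphereOpt

open RealRAM Finset

/-! ### The search program

Natural-number arrays: `0`, `1` input; `2` candidate number; `3` digit counts; `4`, `5` remainder and
quotient; `6` digit position; `7`, `8` loop counters; `9` position in the exponent array;
`10` exponent counter.
Real arrays: `0` input; `1` output; `2` best value; `3` number of candidates; `4` candidate;
`5` its squared norm; `6` value; `7` term. -/

/-- The zeroth cell of an array of natural numbers. -/
def nvar (a : ℕ) : NExp := .get a (.const 0)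

/-- The zeroth cell of an array of reals. -/
def rvar (a : ℕ) : RExp := .get a (.const 0)

/-- Increment the zeroth cell of an array of natural numbers. -/
def incr (a : ℕ) : Prog := .setNat a (.const 0) (.add (nvar a) (.const 1))

/-- The base `2 n` of the digit expansions. -/
def baseExp : NExp := .add (nvar 0) (nvar 0)

/-- The test whether the digit position is below `q / 2`. -/
def digitTest : BExp := .natLt (.add (nvar 6) (nvar 6)) (.get 0 (.const 2))

/-- Clear the digit counts. -/
def clearCounts : Prog :=
  .seq (.setNat 7 (.const 0) (.const 0)) <|
  .while (.natLt (nvar 7) baseExp) <|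
    .seq (.setNat 3 (nvar 7) (.const 0)) (incr 7)

/-- Division with remainder by the base. -/
def divMod : Prog :=
  .seq (.setNat 5 (.const 0) (.const 0)) <|
  .while (.not (.natLt (nvar 4) baseExp)) <|
    .seq (.setNat 4 (.const 0) (.sub (nvar 4) baseExp)) (incr 5)

/-- Count the digits of the candidate number. -/
def countDigits : Prog :=
  .seq (.setNat 4 (.const 0) (nvar 2)) <|
  .seq (.setNat 6 (.const 0) (.const 0)) <|
  .while digitTest <|
    .seq divMod <|
    .seq (.setNat 3 (nvar 4) (.add (.get 3 (nvar 4)) (.const 1))) <|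
    .seq (.setNat 4 (.const 0) (nvar 5)) (incr 6)

/-- Compute the candidate direction and its squared norm. -/
def makeDirection : Prog :=
  .seq (.setNat 7 (.const 0) (.const 0)) <|
  .seq (.setReal 5 (.const 0) (.cast (.const 0))) <|
  .while (.natLt (nvar 7) (nvar 0)) <|
    .seq (.setReal 4 (nvar 7) (.div (.cast (.get 3 (nvar 7)))
      (.sqrt (.cast (.add (.get 3 (nvar 7)) (.get 3 (.add (nvar 0) (nvar 7)))))))) <|
    .seq (.setReal 5 (.const 0) (.add (rvar 5) (.mul (.get 4 (nvar 7)) (.get 4 (nvar 7)))))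
      (incr 7)

/-- Rescale the candidate to the unit sphere. -/
def rescale : Prog :=
  .seq (.setNat 7 (.const 0) (.const 0)) <|
  .while (.natLt (nvar 7) (nvar 0)) <|
    .seq (.setReal 4 (nvar 7) (.div (.get 4 (nvar 7)) (.sqrt (rvar 5)))) (incr 7)

/-- Multiply the current term by the power of the current variable. -/
def mulPower : Prog :=
  .seq (.setNat 10 (.const 0) (.get 1 (nvar 9))) <|
  .while (.natLt (.const 0) (nvar 10)) <|
    .seq (.setReal 7 (.const 0) (.mul (rvar 7) (.get 4 (nvar 7))))
      (.setNat 10 (.const 0) (.sub (nvar 10) (.const 1)))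

/-- Evaluate the current term. -/
def termValue : Prog :=
  .seq (.setReal 7 (.const 0) (.get 0 (nvar 8))) <|
  .seq (.setNat 7 (.const 0) (.const 0)) <|
  .while (.natLt (nvar 7) (nvar 0)) <|
    .seq mulPower <| .seq (incr 9) (incr 7)

/-- Evaluate the polynomial at the candidate. -/
def polyValue : Prog :=
  .seq (.setReal 6 (.const 0) (.cast (.const 0))) <|
  .seq (.setNat 9 (.const 0) (.const 0)) <|
  .seq (.setNat 8 (.const 0) (.const 0)) <|
  .while (.natLt (nvar 8) (.get 0 (.const 3))) <|
    .seq termValue <|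
    .seq (.setReal 6 (.const 0) (.add (rvar 6) (rvar 7))) (incr 8)

/-- Copy the candidate to the output. -/
def copyOut : Prog :=
  .seq (.setNat 7 (.const 0) (.const 0)) <|
  .while (.natLt (nvar 7) (nvar 0)) <|
    .seq (.setReal 1 (nvar 7) (.get 4 (nvar 7))) (incr 7)

/-- Replace the output by the candidate if the latter is better. -/
def keepBest : Prog :=
  .ite (.realLt (rvar 2) (.mul (rvar 6) (rvar 6)))
    (.seq (.setReal 2 (.const 0) (.mul (rvar 6) (rvar 6))) copyOut) .skip

/-- Compute the number `(2 n) ^ (q / 2)` of candidates. -/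
def countCandidates : Prog :=
  .seq (.setReal 3 (.const 0) (.cast (.const 1))) <|
  .while digitTest <|
    .seq (.setReal 3 (.const 0) (.mul (rvar 3) (.cast baseExp))) (incr 6)

/-- Test the current candidate. -/
def tryCandidate : Prog :=
  .seq clearCounts <| .seq countDigits <| .seq makeDirection <| .seq rescale <|
    .seq polyValue keepBest

/-- The search through all candidates. -/
def search : Prog :=
  .seq (.setReal 1 (.const 0) (.cast (.const 1))) <|
  .seq countCandidates <|
  .while (.realLt (.cast (nvar 2)) (rvar 3)) (.seq tryCandidate (incr 2))

/-! ### Correctness and running time of the subroutines -/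

lemma clearCounts_halts (n : ℕ) (s : State) (hn : s.nat 0 0 = n) :
    Halts clearCounts s (6 * n + 2) fun s' =>
      Agree 3 8 s s' ∧ ∀ a < n + n, s'.nat 3 a = 0 := by
  refine Halts.mono (Halts.seq (Halts.setNat (Halts.loop
    (fun i s' => Agree 3 8 s s' ∧ s'.nat 7 0 = i ∧ ∀ a < i, s'.nat 3 a = 0) (n + n) 2
    ?_ ?_ ?_))) (by omega) fun s' h => ⟨h.1, h.2.2⟩
  · rintro i s' - ⟨h1, h2, -⟩
    simp [BExp.holds, NExp.eval, nvar, baseExp, h2, h1.1 0 (by omega), hn]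
  · rintro i s' - ⟨h1, h2, h3⟩
    refine Halts.seq (Halts.setNat (Halts.setNat ⟨?_, ?_, ?_⟩))
    · exact (h1.setNat _ _ (by omega)).setNat _ _ (by omega)
    · simp [NExp.eval, nvar, h2]
    · intro a ha
      simp only [NExp.eval, nvar, h2, State.setNat_nat]
      norm_num
      exact fun _ => h3 a (by omega)
  · refine ⟨(Agree.refl 3 8 s).setNat _ _ (by omega), by simp [NExp.eval], by simp⟩

lemma divMod_halts (n : ℕ) (hn0 : 0 < n) (s : State) (hn : s.nat 0 0 = n) :
    Halts divMod s (3 * s.nat 4 0 + 2) fun s' =>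
      Agree 4 8 s s' ∧ s'.nat 6 0 = s.nat 6 0 ∧ s'.nat 4 0 = s.nat 4 0 % (n + n) ∧
        s'.nat 5 0 = s.nat 4 0 / (n + n) := by
  set k := s.nat 4 0 with hk
  have hle : k / (n + n) ≤ k := Nat.div_le_self _ _
  have hdm := Nat.div_add_mod k (n + n)
  have hlt := Nat.mod_lt k (show 0 < n + n by omega)
  -- Repeated subtraction: remainder plus base times the number of rounds stays equal to the
  -- dividend, and the number of rounds is the quotient.
  refine Halts.mono (Halts.seq (Halts.setNat (Halts.loop
    (fun i s' => Agree 4 8 s s' ∧ s'.nat 6 0 = s.nat 6 0 ∧ s'.nat 4 0 + (n + n) * i = k ∧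
      s'.nat 5 0 = i) (k / (n + n)) 2 ?_ ?_ ?_))) (by omega)
    fun s' h => ⟨h.1, h.2.1, by have := h.2.2.1; omega, h.2.2.2⟩
  · rintro i s' hi ⟨h1, -, h2, h3⟩
    simp only [BExp.holds, NExp.eval, nvar, baseExp, h1.1 0 (by omega), hn, not_lt]
    rw [← Nat.succ_le_iff, Nat.le_div_iff_mul_le (by omega), Nat.succ_mul, mul_comm i]
    omega
  · rintro i s' hi ⟨h1, h2, h3, h4⟩
    refine Halts.seq (Halts.setNat (Halts.setNat ⟨?_, ?_, ?_, ?_⟩))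
    · exact (h1.setNat _ _ (by omega)).setNat _ _ (by omega)
    · simpa using h2
    · rw [← Nat.succ_le_iff, Nat.le_div_iff_mul_le (by omega), Nat.succ_mul, mul_comm i] at hi
      simp only [NExp.eval, nvar, baseExp, State.setNat_nat, h1.1 0 (by omega), hn]
      rw [mul_add]
      norm_num
      omega
    · simp [NExp.eval, nvar, h4]
  · refine ⟨(Agree.refl 4 8 s).setNat _ _ (by omega), by simp, by simp [hk], by simp [NExp.eval]⟩

/-- The number of occurrences of the digit `a` among the last `l` digits of `K` in base `B`. -/
def digitCount (B K l a : ℕ) : ℕ := #{j ∈ range l | K / B ^ j % B = a}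

lemma digitCount_succ (B K l a : ℕ) :
    digitCount B K (l + 1) a = digitCount B K l a + if a = K / B ^ l % B then 1 else 0 := by
  rw [digitCount, range_add_one, filter_insert]
  by_cases h : K / B ^ l % B = a
  · rw [if_pos h, card_insert_of_notMem (by simp), if_pos h.symm, digitCount]
  · rw [if_neg h, if_neg (Ne.symm h), digitCount, add_zero]

lemma countDigits_halts (n h K : ℕ) (hn0 : 0 < n) (s : State) (hn : s.nat 0 0 = n)
    (hq : s.nat 0 2 = 2 * h) (hK : s.nat 2 0 = K) (hz : ∀ a < n + n, s.nat 3 a = 0) :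
    Halts countDigits s (h * (3 * K + 6) + 3) fun s' =>
      Agree 3 8 s s' ∧ ∀ a < n + n, s'.nat 3 a = digitCount (n + n) K h a := by
  refine Halts.mono (Halts.seq (Halts.setNat (Halts.seq (Halts.setNat (Halts.loop
    (fun i s' => Agree 3 8 s s' ∧ s'.nat 6 0 = i ∧ s'.nat 4 0 = K / (n + n) ^ i ∧
      ∀ a < n + n, s'.nat 3 a = digitCount (n + n) K i a) h (3 * K + 5) ?_ ?_ ?_)))))
    (le_of_eq (by ring)) fun s' h => ⟨h.1, h.2.2.2⟩
  · rintro i s' - ⟨h1, h2, -, -⟩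
    simp only [digitTest, BExp.holds, NExp.eval, nvar, h1.1 0 (by omega), hq, h2]
    omega
  · rintro i s' - ⟨h1, h2, h3, h4⟩
    refine Halts.mono (Halts.seq (Halts.mono (divMod_halts n hn0 s' (by
      rw [h1.1 0 (by omega), hn])) le_rfl fun s₁ ⟨k1, k2, k3, k4⟩ => Halts.seq (Halts.setNat
        (Halts.seq (Halts.setNat (Halts.setNat ⟨?_, ?_, ?_, ?_⟩)))))) ?_ fun _ h => h
    · have : s'.nat 4 0 ≤ K := by rw [h3]; exact Nat.div_le_self _ _
      omega
    · exact (((h1.trans (k1.mono (by omega) le_rfl)).setNat _ _ (by omega)).setNat _ _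
        (by omega)).setNat _ _ (by omega)
    · simp [NExp.eval, nvar, k2, h2]
    · simp [NExp.eval, nvar, k4, h3, Nat.div_div_eq_div_mul, pow_succ]
    · intro a ha
      rw [digitCount_succ, ← h3, ← k3, ← h4 a ha]
      have hlt : s₁.nat 4 0 < n + n := by rw [k3]; exact Nat.mod_lt _ (by omega)
      simp only [NExp.eval, nvar, State.setNat_nat]
      norm_num
      rw [k1.1 3 (by omega)]
      split_ifs with h5
      · rw [h5]
      · rfl
  · refine ⟨((Agree.refl 3 8 s).setNat _ _ (by omega)).setNat _ _ (by omega), by simp [NExp.eval],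
      by simp [NExp.eval, nvar, hK], fun a ha => ?_⟩
    simp [hz a ha, digitCount]

lemma makeDirection_halts (n : ℕ) (s : State) (hn : s.nat 0 0 = n) (y : ℕ → ℝ)
    (hy : ∀ i < n, y i = (s.nat 3 i : ℝ) / √((s.nat 3 i + s.nat 3 (n + i) : ℕ) : ℝ)) :
    Halts makeDirection s (4 * n + 3) fun s' =>
      Agree 4 4 s s' ∧ (∀ i < n, s'.real 4 i = y i) ∧
        s'.real 5 0 = ∑ i ∈ range n, y i * y i := by
  refine Halts.mono (Halts.seq (Halts.setNat (Halts.seq (Halts.setReal (Halts.loop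
    (fun i s' => Agree 4 4 s s' ∧ s'.nat 7 0 = i ∧ (∀ j < i, s'.real 4 j = y j) ∧
      s'.real 5 0 = ∑ j ∈ range i, y j * y j) n 3 ?_ ?_ ?_)))))
    (by omega) fun s' h => ⟨h.1, h.2.2⟩
  · rintro i s' - ⟨h1, h2, -, -⟩
    simp [BExp.holds, NExp.eval, nvar, h1.1 0 (by omega), hn, h2]
  · rintro i s' hi ⟨h1, h2, h3, h4⟩
    have e : ((s'.nat 3 i : ℕ) : ℝ) / √((s'.nat 3 i + s'.nat 3 (n + i) : ℕ) : ℝ) = y i := by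
      rw [hy i hi, h1.1 3 (by omega)]
    refine Halts.seq (Halts.setReal (Halts.seq (Halts.setReal (Halts.setNat ⟨?_, ?_, ?_, ?_⟩))))
    · exact ((h1.setReal _ _ (by omega)).setReal _ _ (by omega)).setNat _ _ (by omega)
    · simp [NExp.eval, nvar, h2]
    · intro j hj
      simp only [NExp.eval, RExp.eval, nvar, rvar, State.setReal_real, State.setNat_real,
        State.setReal_nat, h1.1 0 (by omega), hn, h2, e]
      norm_num
      split_ifs with h5
      · rw [h5]
      · exact h3 j (by omega)
    · simp only [NExp.eval, RExp.eval, nvar, rvar, State.setReal_real, State.setNat_real,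
        State.setReal_nat, h1.1 0 (by omega), hn, h2, e]
      norm_num
      rw [sum_range_succ, h4]
  · refine ⟨((Agree.refl 4 4 s).setNat _ _ (by omega)).setReal _ _ (by omega), by simp [NExp.eval],
      by simp, by simp [RExp.eval, NExp.eval]⟩

lemma rescale_halts (n : ℕ) (s : State) (hn : s.nat 0 0 = n) :
    Halts rescale s (3 * n + 2) fun s' =>
      Agree 4 4 s s' ∧ (∀ i < n, s'.real 4 i = s.real 4 i / √(s.real 5 0)) := by
  -- The array is overwritten in place, so the invariant must also record that the cells from `i` on
  -- are untouched.
  refine Halts.mono (Halts.seq (Halts.setNat (Halts.loop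
    (fun i s' => Agree 4 4 s s' ∧ s'.nat 7 0 = i ∧ s'.real 5 0 = s.real 5 0 ∧
      (∀ j < i, s'.real 4 j = s.real 4 j / √(s.real 5 0)) ∧
      ∀ j, i ≤ j → s'.real 4 j = s.real 4 j) n 2 ?_ ?_ ?_)))
    (by omega) fun s' h => ⟨h.1, h.2.2.2.1⟩
  · rintro i s' - ⟨h1, h2, -⟩
    simp [BExp.holds, NExp.eval, nvar, h1.1 0 (by omega), hn, h2]
  · rintro i s' hi ⟨h1, h2, h3, h4, h5⟩
    refine Halts.seq (Halts.setReal (Halts.setNat ⟨?_, ?_, ?_, ?_, ?_⟩))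
    · exact (h1.setReal _ _ (by omega)).setNat _ _ (by omega)
    · simp [NExp.eval, nvar, h2]
    · simpa using h3
    · intro j hj
      simp only [NExp.eval, RExp.eval, nvar, rvar, State.setReal_real, State.setNat_real, h2, h3,
        true_and]
      split_ifs with h6
      · rw [h6, h5 i le_rfl]
      · exact h4 j (by omega)
    · intro j hj
      simp only [NExp.eval, RExp.eval, nvar, rvar, State.setReal_real, State.setNat_real, h2, h3]
      rw [if_neg (by omega), h5 j (by omega)]
  · refine ⟨(Agree.refl 4 4 s).setNat _ _ (by omega), by simp [NExp.eval], by simp, by simp,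
      by simp⟩

lemma mulPower_halts (s : State) :
    Halts mulPower s (3 * s.nat 1 (s.nat 9 0) + 2) fun s' =>
      Agree 10 7 s s' ∧ s'.real 7 0 =
        s.real 7 0 * s.real 4 (s.nat 7 0) ^ s.nat 1 (s.nat 9 0) := by
  set e := s.nat 1 (s.nat 9 0) with he
  refine Halts.mono (Halts.seq (Halts.setNat (Halts.loop
    (fun i s' => Agree 10 7 s s' ∧ s'.nat 10 0 = e - i ∧
      s'.real 7 0 = s.real 7 0 * s.real 4 (s.nat 7 0) ^ i) e 2 ?_ ?_ ?_)))
    (by omega) fun s' h => ⟨h.1, h.2.2⟩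
  · rintro i s' - ⟨h1, h2, -⟩
    simp [BExp.holds, NExp.eval, nvar, h2]
  · rintro i s' hi ⟨h1, h2, h3⟩
    refine Halts.seq (Halts.setReal (Halts.setNat ⟨?_, ?_, ?_⟩))
    · exact (h1.setReal _ _ (by omega)).setNat _ _ (by omega)
    · simp [NExp.eval, nvar, h2]
      omega
    · simp [NExp.eval, RExp.eval, nvar, rvar, h3, h1.1 7 (by omega), h1.2 4 (by omega)]
      ring
  · refine ⟨(Agree.refl 10 7 s).setNat _ _ (by omega), by simp [NExp.eval, nvar, he], by simp⟩

/-- Natural numbers cannot be multiplied in one step, so the position `j * n + i` is kept in a cell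
that advances through the exponent array; it ends at the start of the next monomial. -/
lemma termValue_halts (n d j : ℕ) (s : State) (hn : s.nat 0 0 = n) (hj : s.nat 8 0 = j)
    (hp : s.nat 9 0 = j * n) (hd : ∀ i < n, s.nat 1 (j * n + i) ≤ d) :
    Halts termValue s (n * (3 * d + 5) + 3) fun s' =>
      Agree 7 7 s s' ∧ s'.nat 8 0 = j ∧ s'.nat 9 0 = (j + 1) * n ∧
        s'.real 7 0 = s.real 0 j * ∏ i ∈ range n, s.real 4 i ^ s.nat 1 (j * n + i) := by
  refine Halts.mono (Halts.seq (Halts.setReal (Halts.seq (Halts.setNat (Halts.loop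
    (fun i s' => Agree 7 7 s s' ∧ s'.nat 7 0 = i ∧ s'.nat 8 0 = j ∧ s'.nat 9 0 = j * n + i ∧
      s'.real 7 0 = s.real 0 j * ∏ i ∈ range i, s.real 4 i ^ s.nat 1 (j * n + i))
    n (3 * d + 4) ?_ ?_ ?_)))))
    (le_of_eq (by ring)) fun s' h => ⟨h.1, h.2.2.1, by rw [h.2.2.2.1]; ring, h.2.2.2.2⟩
  · rintro i s' - ⟨h1, h2, -⟩
    simp [BExp.holds, NExp.eval, nvar, h1.1 0 (by omega), hn, h2]
  · rintro i s' hi ⟨h1, h2, h3, h4, h5⟩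
    refine Halts.mono (Halts.seq (Halts.mono (mulPower_halts s') le_rfl fun s₁ ⟨k1, k2⟩ =>
      Halts.seq (Halts.setNat (Halts.setNat ⟨?_, ?_, ?_, ?_, ?_⟩)))) ?_ fun _ h => h
    · have := hd i hi
      rw [h4, h1.1 1 (by omega)]
      omega
    · exact ((h1.trans (k1.mono (by omega) le_rfl)).setNat _ _ (by omega)).setNat _ _ (by omega)
    · simp [NExp.eval, nvar, k1.1 7 (by omega), h2]
    · simp [NExp.eval, nvar, k1.1 8 (by omega), h3]
    · simp [NExp.eval, nvar, k1.1 9 (by omega), h4]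
      omega
    · simp only [State.setNat_real]
      rw [k2, h5, h4, h2, h1.1 1 (by omega), h1.2 4 (by omega), prod_range_succ]
      ring
  · refine ⟨((Agree.refl 7 7 s).setReal _ _ (by omega)).setNat _ _ (by omega), by simp [NExp.eval],
      by simp [hj], by simp [hp], by simp [RExp.eval, NExp.eval, nvar, hj]⟩

lemma polyValue_halts (n d m : ℕ) (s : State) (hn : s.nat 0 0 = n) (hm : s.nat 0 3 = m)
    (hd : ∀ j < m, ∀ i < n, s.nat 1 (j * n + i) ≤ d) :
    Halts polyValue s (m * (n * (3 * d + 5) + 6) + 4) fun s' =>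
      Agree 7 5 s s' ∧ s'.real 6 0 =
        ∑ j ∈ range m, s.real 0 j * ∏ i ∈ range n, s.real 4 i ^ s.nat 1 (j * n + i) := by
  refine Halts.mono (Halts.seq (Halts.setReal (Halts.seq (Halts.setNat (Halts.seq (Halts.setNat
    (Halts.loop (fun j s' => Agree 7 5 s s' ∧ s'.nat 8 0 = j ∧ s'.nat 9 0 = j * n ∧
      s'.real 6 0 =
        ∑ j ∈ range j, s.real 0 j * ∏ i ∈ range n, s.real 4 i ^ s.nat 1 (j * n + i))
    m (n * (3 * d + 5) + 5) ?_ ?_ ?_)))))))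
    (le_of_eq (by ring)) fun s' h => ⟨h.1, h.2.2.2⟩
  · rintro i s' - ⟨h1, h2, -⟩
    simp [BExp.holds, NExp.eval, nvar, h1.1 0 (by omega), hm, h2]
  · rintro j s' hj ⟨h1, h2, h3, h4⟩
    refine Halts.mono (Halts.seq (Halts.mono (termValue_halts n d j s'
      (by rw [h1.1 0 (by omega), hn]) h2 h3 (by rw [h1.1 1 (by omega)]; exact hd j hj)) le_rfl
      fun s₁ ⟨k1, k2, k3, k4⟩ => Halts.seq (Halts.setReal (Halts.setNat ⟨?_, ?_, ?_, ?_⟩))))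
      (by omega) fun _ h => h
    · exact ((h1.trans (k1.mono (by omega) (by omega))).setReal _ _ (by omega)).setNat _ _
        (by omega)
    · simp [NExp.eval, nvar, k2]
    · simp [k3]
    · simp only [State.setNat_real, State.setReal_real, RExp.eval, NExp.eval, rvar, and_self,
        if_true]
      rw [k4, k1.2 6 (by omega), h4, sum_range_succ, h1.1 1 (by omega), h1.2 0 (by omega),
        h1.2 4 (by omega)]
  · refine ⟨(((Agree.refl 7 5 s).setReal _ _ (by omega)).setNat _ _ (by omega)).setNat _ _
      (by omega), by simp [NExp.eval], by simp [NExp.eval], by simp [RExp.eval, NExp.eval]⟩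

lemma copyOut_halts (n : ℕ) (s : State) (hn : s.nat 0 0 = n) :
    Halts copyOut s (3 * n + 2) fun s' =>
      Agree 7 1 s s' ∧ s'.real 2 = s.real 2 ∧ s'.real 3 = s.real 3 ∧
        ∀ i < n, s'.real 1 i = s.real 4 i := by
  refine Halts.mono (Halts.seq (Halts.setNat (Halts.loop
    (fun i s' => Agree 7 1 s s' ∧ s'.nat 7 0 = i ∧ s'.real 2 = s.real 2 ∧ s'.real 3 = s.real 3 ∧
      s'.real 4 = s.real 4 ∧ ∀ j < i, s'.real 1 j = s.real 4 j) n 2 ?_ ?_ ?_)))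
    (by omega) fun s' h => ⟨h.1, h.2.2.1, h.2.2.2.1, h.2.2.2.2.2⟩
  · rintro i s' - ⟨h1, h2, -⟩
    simp [BExp.holds, NExp.eval, nvar, h1.1 0 (by omega), hn, h2]
  · rintro i s' hi ⟨h1, h2, h3, h4, h5, h6⟩
    refine Halts.seq (Halts.setReal (Halts.setNat ⟨?_, ?_, ?_, ?_, ?_, ?_⟩))
    · exact (h1.setReal _ _ (by omega)).setNat _ _ (by omega)
    · simp [NExp.eval, nvar, h2]
    · rw [← h3]; funext j; simp
    · rw [← h4]; funext j; simp
    · rw [← h5]; funext j; simp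
    · intro j hj
      simp only [NExp.eval, RExp.eval, nvar, State.setReal_real, State.setNat_real, h2, h5,
        true_and]
      split_ifs with h7
      · rw [h7]
      · exact h6 j (by omega)
  · refine ⟨(Agree.refl 7 1 s).setNat _ _ (by omega), by simp [NExp.eval], by simp, by simp,
      by simp, by simp⟩

/-- Squares of values are compared, which replaces absolute values. -/
lemma keepBest_halts (n : ℕ) (s : State) (hn : s.nat 0 0 = n) :
    Halts keepBest s (3 * n + 4) fun s' =>
      Agree 7 1 s s' ∧ s'.real 3 = s.real 3 ∧
        (s.real 6 0 * s.real 6 0 ≤ s.real 2 0 ∧ s'.real 2 0 = s.real 2 0 ∧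
            s'.real 1 = s.real 1 ∨
          s.real 2 0 < s.real 6 0 * s.real 6 0 ∧ s'.real 2 0 = s.real 6 0 * s.real 6 0 ∧
            ∀ i < n, s'.real 1 i = s.real 4 i) := by
  refine Halts.mono (Halts.ite (T := 3 * n + 3) (fun hb => ?_) fun hb => ?_) (by omega)
    fun _ h => h
  · simp only [BExp.holds, RExp.eval, rvar, NExp.eval] at hb
    refine Halts.mono (Halts.seq (Halts.setReal (Halts.mono (copyOut_halts n _ ?_) le_rfl
      fun s' ⟨h1, h2, h3, h4⟩ => ?_))) (by omega) fun _ h => h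
    · exact hn
    · refine ⟨((Agree.refl 7 1 s).setReal _ _ (by omega)).trans h1, ?_, Or.inr ⟨hb, ?_, ?_⟩⟩
      · rw [h3]; funext j; simp
      · rw [h2]; simp [RExp.eval, NExp.eval, rvar]
      · intro i hi
        rw [h4 i hi]; simp
  · simp only [BExp.holds, RExp.eval, rvar, NExp.eval, not_lt] at hb
    exact Halts.mono (Halts.skip ⟨Agree.refl 7 1 s, rfl, Or.inl ⟨hb, rfl, rfl⟩⟩) (by omega)
      fun _ h => h

/-- The count is held exactly as a real, where multiplication costs one step. The program does not
reset the counter, whence the assumption that it starts at 0. -/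
lemma countCandidates_halts (n h : ℕ) (s : State) (hn : s.nat 0 0 = n) (hq : s.nat 0 2 = 2 * h)
    (h6 : s.nat 6 0 = 0) :
    Halts countCandidates s (3 * h + 2) fun s' =>
      Agree 6 3 s s' ∧ s'.real 3 0 = (((n + n) ^ h : ℕ) : ℝ) := by
  refine Halts.mono (Halts.seq (Halts.setReal (Halts.loop
    (fun i s' => Agree 6 3 s s' ∧ s'.nat 6 0 = i ∧ s'.real 3 0 = (((n + n) ^ i : ℕ) : ℝ)) h 2
    ?_ ?_ ?_))) (by omega) fun s' h => ⟨h.1, h.2.2⟩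
  · rintro i s' - ⟨h1, h2, -⟩
    simp only [digitTest, BExp.holds, NExp.eval, nvar, h1.1 0 (by omega), hq, h2]
    omega
  · rintro i s' hi ⟨h1, h2, h3⟩
    refine Halts.seq (Halts.setReal (Halts.setNat ⟨?_, ?_, ?_⟩))
    · exact (h1.setReal _ _ (by omega)).setNat _ _ (by omega)
    · simp [NExp.eval, nvar, h2]
    · simp [NExp.eval, RExp.eval, nvar, rvar, baseExp, h3, h1.1 0 (by omega), hn, pow_succ]
  · refine ⟨(Agree.refl 6 3 s).setReal _ _ (by omega), by simp [h6], by simp [RExp.eval, NExp.eval]⟩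

end SphereOpt

namespace SphereOpt

open RealRAM Finset

/-! ### Candidates and digit expansions -/

/-- Enumerate the disjoint union of blocks of sizes `c a` by `Fin h` and send each index to its
block. -/
lemma exists_card_fiber_eq {α : Type*} [Fintype α] [DecidableEq α] (c : α → ℕ) (h : ℕ)
    (hc : ∑ a, c a = h) : ∃ D : Fin h → α, ∀ a, #{j | D j = a} = c a := by
  have hcard : Fintype.card (Σ a, Fin (c a)) = h := by simp [hc]
  let e := Fintype.equivFinOfCardEq hcard
  refine ⟨fun j => (e.symm j).1, fun a => ?_⟩
  symm
  rw [← Fintype.card_fin (c a), ← card_univ]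
  refine card_bij (fun i _ => e ⟨a, i⟩) (by simp) ?_ ?_
  · intro i _ j _ hij
    simpa using hij
  · intro j hj
    simp only [mem_filter, mem_univ, true_and] at hj
    subst hj
    exact ⟨(e.symm j).2, mem_univ _, by simp⟩

lemma exists_digitCount_eq (B h : ℕ) (c : Fin B → ℕ) (hc : ∑ a, c a = h) :
    ∃ K < B ^ h, ∀ a : Fin B, digitCount B K h a = c a := by
  obtain ⟨D, hD⟩ := exists_card_fiber_eq c h hc
  refine ⟨finFunctionFinEquiv D, (finFunctionFinEquiv D).2, fun a => ?_⟩
  rw [← hD a, digitCount, card_filter, card_filter, sum_range]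
  refine sum_congr rfl fun j _ => ?_
  have : ((finFunctionFinEquiv D : Fin (B ^ h)) : ℕ) / B ^ (j : ℕ) % B = D j := by
    conv_rhs => rw [← finFunctionFinEquiv.symm_apply_apply D]
    exact (finFunctionFinEquiv_symm_apply_val _ _).symm
  rw [this]
  simp only [Fin.ext_iff]

/-- The `K`-th candidate. -/
noncomputable def candidate (n h K : ℕ) : Fin n → ℝ :=
  normalize (direction (fun i => digitCount (n + n) K h i)
    fun i => digitCount (n + n) K h i + digitCount (n + n) K h (n + i))

/-- Use a word in which letter `i` occurs `b i` times and letter `n + i` occurs `g i - b i` times;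
its length is `∑ g i = h`. -/
lemma exists_candidate_eq {n h : ℕ} (g b : Fin n → ℕ) (hg : ∑ i, g i = h) (hb : ∀ i, b i ≤ g i) :
    ∃ K < (n + n) ^ h, candidate n h K = normalize (direction b g) := by
  obtain ⟨K, hK, hc⟩ := exists_digitCount_eq (n + n) h
    (Fin.addCases b fun i => g i - b i) (by
      rw [Fin.sum_univ_add]
      simp only [Fin.addCases_left, Fin.addCases_right]
      rw [← sum_add_distrib, ← hg]
      exact sum_congr rfl fun i _ => by have := hb i; omega)
  have h1 : ∀ i : Fin n, digitCount (n + n) K h i = b i := fun i => by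
    simpa using hc (Fin.castAdd n i)
  have h2 : ∀ i : Fin n, digitCount (n + n) K h (n + i) = g i - b i := fun i =>
    (hc (Fin.natAdd n i)).trans (Fin.addCases_right i)
  refine ⟨K, hK, ?_⟩
  rw [candidate]
  congr 2
  · exact funext h1
  · funext i
    have := hb i
    rw [h1, h2]
    omega

lemma degree_eq_of_mem_support {n d : ℕ} {f : MvPolynomial (Fin n) ℝ} (hf : f.IsHomogeneous d)
    {μ : Fin n →₀ ℕ} (hμ : μ ∈ f.support) : μ.degree = d := by
  by_contra hne
  exact (MvPolynomial.mem_support_iff.1 hμ) (hf.coeff_eq_zero hne)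

/-- Spelling each monomial as a word of length `d` in the variables is injective, since letter
counts recover the exponents. This bounds the cost of evaluating `f`. -/
lemma card_support_le_pow {n d : ℕ} {f : MvPolynomial (Fin n) ℝ} (hf : f.IsHomogeneous d) :
    #f.support ≤ n ^ d := by
  have h1 : ∀ μ : f.support, ∃ D : Fin d → Fin n, ∀ a, #{j | D j = a} = μ.1 a := fun μ =>
    exists_card_fiber_eq _ d (by rw [← Finsupp.degree_eq_sum, degree_eq_of_mem_support hf μ.2])
  choose D hD using h1
  have hinj : Function.Injective D := by
    intro μ ν h
    ext a
    rw [← hD μ a, ← hD ν a, h]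
  simpa using Fintype.card_le_of_injective D hinj

/-! ### The input encoding -/

section Input

variable {n d q : ℕ} {f : MvPolynomial (Fin n) ℝ} {L : List (Fin n →₀ ℕ)}

lemma toFinset_eq_support (hL : ∀ μ, μ ∈ L ↔ μ ∈ f.support) : L.toFinset = f.support := by
  ext μ
  rw [List.mem_toFinset, hL]

lemma length_eq_card_support (hnd : L.Nodup) (hL : ∀ μ, μ ∈ L ↔ μ ∈ f.support) :
    L.length = #f.support := by
  rw [← toFinset_eq_support hL, List.toFinset_card_of_nodup hnd]

lemma inputState_exponent {j : ℕ} (hj : j < L.length) (i : Fin n) :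
    (inputState d q f L).nat 1 (j * n + i) = L[j] i := by
  have hn : 0 < n := i.pos
  have h1 : (j * n + i) / n = j := by
    rw [mul_comm, Nat.mul_add_div hn, Nat.div_eq_of_lt i.2, add_zero]
  have h2 : (j * n + i) % n = i := by
    rw [mul_comm, Nat.mul_add_mod, Nat.mod_eq_of_lt i.2]
  simp [inputState, hn, h1, h2, hj]

lemma inputState_coeff {j : ℕ} (hj : j < L.length) :
    (inputState d q f L).real 0 j = f.coeff L[j] := by
  simp [inputState, hj]

lemma inputState_exponent_le (hf : f.IsHomogeneous d) (hL : ∀ μ, μ ∈ L ↔ μ ∈ f.support) {j i : ℕ}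
    (hj : j < L.length) (hi : i < n) : (inputState d q f L).nat 1 (j * n + i) ≤ d := by
  have h1 := inputState_exponent (d := d) (q := q) (f := f) hj ⟨i, hi⟩
  simp only at h1
  rw [h1]
  have h2 := degree_eq_of_mem_support hf ((hL _).1 (List.getElem_mem hj))
  rw [← h2, Finsupp.degree_eq_sum]
  exact single_le_sum (f := fun i => L[j] i) (fun _ _ => Nat.zero_le _) (mem_univ _)

lemma sum_inputState_eq_eval (hnd : L.Nodup) (hL : ∀ μ, μ ∈ L ↔ μ ∈ f.support) (x : ℕ → ℝ) :
    ∑ j ∈ range L.length, (inputState d q f L).real 0 j *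
        ∏ i ∈ range n, x i ^ (inputState d q f L).nat 1 (j * n + i) =
      MvPolynomial.eval (fun i : Fin n => x i) f := by
  rw [MvPolynomial.eval_eq', ← toFinset_eq_support hL, List.sum_toFinset _ hnd,
    ← Fin.sum_univ_fun_getElem, sum_range]
  refine sum_congr rfl fun j _ => ?_
  rw [inputState_coeff j.2, prod_range]
  congr 1
  exact prod_congr rfl fun i _ => by rw [inputState_exponent j.2]

end Input

/-! ### Correctness of the search -/

lemma sq_sum_range {n : ℕ} (y : ℕ → ℝ) (x : Fin n → ℝ) (hyx : ∀ i : Fin n, y i = x i) :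
    ∑ i ∈ range n, y i * y i = ∑ i, x i * x i := by
  rw [sum_range]
  exact sum_congr rfl fun i _ => by rw [hyx]

section Search

variable {n d q h : ℕ} {f : MvPolynomial (Fin n) ℝ} {L : List (Fin n →₀ ℕ)}

lemma tryCandidate_halts (hn0 : 0 < n) (hq : q = 2 * h) (hf : f.IsHomogeneous d) (hnd : L.Nodup)
    (hL : ∀ μ, μ ∈ L ↔ μ ∈ f.support) (K : ℕ) (s : State)
    (hs : Agree 2 1 (inputState d q f L) s) (hK : s.nat 2 0 = K) :
    Halts tryCandidate s
      ((6 * n + 2) + ((h * (3 * K + 6) + 3) + ((4 * n + 3) + ((3 * n + 2) +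
        ((L.length * (n * (3 * d + 5) + 6) + 4) + (3 * n + 4)))))) fun s' =>
      Agree 3 1 s s' ∧ s'.real 3 = s.real 3 ∧
        (MvPolynomial.eval (candidate n h K) f ^ 2 ≤ s.real 2 0 ∧ s'.real 2 0 = s.real 2 0 ∧
            s'.real 1 = s.real 1 ∨
          s.real 2 0 < MvPolynomial.eval (candidate n h K) f ^ 2 ∧
            s'.real 2 0 = MvPolynomial.eval (candidate n h K) f ^ 2 ∧
            output n s' = candidate n h K) := by
  have e0 : s.nat 0 0 = n := by rw [hs.1 0 (by omega)]; rfl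
  have e2 : s.nat 0 2 = 2 * h := by rw [hs.1 0 (by omega), ← hq]; rfl
  have e3 : s.nat 0 3 = L.length := by rw [hs.1 0 (by omega)]; rfl
  set x : Fin n → ℝ := direction (fun i => digitCount (n + n) K h i)
    (fun i => digitCount (n + n) K h i + digitCount (n + n) K h (n + i)) with hx
  refine Halts.seq (Halts.mono (clearCounts_halts n s e0) le_rfl fun s₁ ⟨a1, a2⟩ => ?_)
  refine Halts.seq (Halts.mono (countDigits_halts n h K hn0 s₁ (by rw [a1.1 0 (by omega), e0])
    (by rw [a1.1 0 (by omega), e2]) (by rw [a1.1 2 (by omega), hK]) a2) le_rfl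
    fun s₂ ⟨b1, b2⟩ => ?_)
  have A2 := a1.trans b1
  refine Halts.seq (Halts.mono (makeDirection_halts n s₂ (by rw [A2.1 0 (by omega), e0])
    (fun i => (s₂.nat 3 i : ℝ) / √((s₂.nat 3 i + s₂.nat 3 (n + i) : ℕ) : ℝ)) fun _ _ => rfl) le_rfl
    fun s₃ ⟨c1, c2, c3⟩ => ?_)
  have A3 := (A2.mono (c' := 3) (r' := 4) (by omega) (by omega)).trans (c1.mono (by omega) le_rfl)
  have hy : ∀ i : Fin n,
      (s₂.nat 3 i : ℝ) / √((s₂.nat 3 i + s₂.nat 3 (n + i) : ℕ) : ℝ) = x i := by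
    intro i
    rw [b2 i (by omega), b2 (n + i) (by omega), hx, direction]
  rw [sq_sum_range _ x hy] at c3
  refine Halts.seq (Halts.mono (rescale_halts n s₃ (by rw [A3.1 0 (by omega), e0])) le_rfl
    fun s₄ ⟨d1, d2⟩ => ?_)
  have A4 := A3.trans (d1.mono (by omega) le_rfl)
  have hcand : (fun i : Fin n => s₄.real 4 i) = candidate n h K := by
    funext i
    rw [d2 i i.2, c2 i i.2, hy i, c3]
    rfl
  have AI := (A4.mono (c' := 2) (r' := 1) (by omega) (by omega))
  have AI' := hs.trans AI
  refine Halts.seq (Halts.mono (polyValue_halts n d L.length s₄ (by rw [A4.1 0 (by omega), e0])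
    (by rw [A4.1 0 (by omega), e3]) fun j hj i hi => ?_) le_rfl fun s₅ ⟨f1, f2⟩ => ?_)
  · rw [AI'.1 1 (by omega)]
    exact inputState_exponent_le hf hL hj hi
  rw [AI'.1 1 (by omega), AI'.2 0 (by omega), sum_inputState_eq_eval hnd hL, hcand] at f2
  have A5 := A4.trans (f1.mono (by omega) (by omega))
  refine Halts.mono (keepBest_halts n s₅ (by rw [A5.1 0 (by omega), e0])) le_rfl
    fun s₆ ⟨g1, g2, g3⟩ => ?_
  refine ⟨(A5.mono le_rfl (by omega)).trans (g1.mono (by omega) le_rfl), ?_, ?_⟩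
  · rw [g2, A5.2 3 (by omega)]
  · rw [f2, ← pow_two, A5.2 2 (by omega), A5.2 1 (by omega)] at g3
    refine g3.imp_right fun ⟨k1, k2, k3⟩ => ⟨k1, k2, ?_⟩
    rw [← hcand]
    funext i
    rw [output, k3 i i.2, f1.2 4 (by omega)]

lemma eval_normalize_zero (hd : 0 < d) (hf : f.IsHomogeneous d) :
    MvPolynomial.eval (normalize (0 : Fin n → ℝ)) f = 0 := by
  have h0 : (normalize 0 : Fin n → ℝ) = fun i => 0 * (0 : Fin n → ℝ) i := by
    funext i
    simp [normalize]
  rw [h0, eval_smul_of_isHomogeneous hf, zero_pow hd.ne', zero_mul]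

/-- Only a zero direction fails to normalize to a unit vector, and there `f` vanishes because `d >
0`. -/
lemma sum_candidate_sq (hd : 0 < d) (hf : f.IsHomogeneous d) (K : ℕ)
    (hne : MvPolynomial.eval (candidate n h K) f ≠ 0) : ∑ i, candidate n h K i ^ 2 = 1 := by
  refine sum_normalize_sq _ fun h0 => hne ?_
  rw [candidate, h0, eval_normalize_zero hd hf]

lemma search_halts (hn0 : 0 < n) (hd : 0 < d) (hq : q = 2 * h) (hf : f.IsHomogeneous d)
    (hnd : L.Nodup) (hL : ∀ μ, μ ∈ L ↔ μ ∈ f.support) :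
    Halts search (inputState d q f L)
      (1 + ((3 * h + 2) + ((n + n) ^ h * (((6 * n + 2) + ((h * (3 * (n + n) ^ h + 6) + 3) +
        ((4 * n + 3) + ((3 * n + 2) + ((L.length * (n * (3 * d + 5) + 6) + 4) + (3 * n + 4)))))) + 1
          + 1) + 1))) fun s =>
      ∑ i, output n s i ^ 2 = 1 ∧ ∀ K < (n + n) ^ h,
        MvPolynomial.eval (candidate n h K) f ^ 2 ≤ MvPolynomial.eval (output n s) f ^ 2 := by
  refine Halts.seq (Halts.setReal ?_)
  set s₀ := (inputState d q f L).setReal 1 ((NExp.const 0).eval (inputState d q f L))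
    ((RExp.cast (.const 1)).eval (inputState d q f L)) with hs₀
  have a0 : Agree 2 1 (inputState d q f L) s₀ := (Agree.refl 2 1 _).setReal _ _ le_rfl
  -- The initial output is the first basis vector; it remains the answer if `f` vanishes at every
  -- candidate.
  have hout : ∑ i, output n s₀ i ^ 2 = 1 := by
    have : ∀ i : Fin n, output n s₀ i ^ 2 = if i = ⟨0, hn0⟩ then 1 else 0 := by
      intro i
      by_cases hi : (i : ℕ) = 0 <;>
        simp [output, hs₀, NExp.eval, RExp.eval, inputState, Fin.ext_iff, hi]
    simp [this]
  refine Halts.seq (Halts.mono (countCandidates_halts n h s₀ (by rw [a0.1 0 (by omega)]; rfl)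
    (by rw [a0.1 0 (by omega), ← hq]; rfl) rfl) le_rfl fun s₁ ⟨b1, b2⟩ => ?_)
  have a1 := a0.trans (b1.mono (by omega) (by omega))
  -- The recorded best value is only required to be at most the squared value at the output: it
  -- starts at 0, while `f` need not vanish at the first basis vector.
  refine Halts.mono (Halts.loop (fun K s => Agree 2 1 (inputState d q f L) s ∧ s.nat 2 0 = K ∧
    s.real 3 0 = (((n + n) ^ h : ℕ) : ℝ) ∧ ∑ i, output n s i ^ 2 = 1 ∧ 0 ≤ s.real 2 0 ∧
    s.real 2 0 ≤ MvPolynomial.eval (output n s) f ^ 2 ∧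
    ∀ K' < K, MvPolynomial.eval (candidate n h K') f ^ 2 ≤ s.real 2 0) ((n + n) ^ h) _
    ?_ ?_ ?_) le_rfl fun s ⟨_, _, _, c1, _, c2, c3⟩ => ⟨c1, fun K hK => (c3 K hK).trans c2⟩
  · rintro K s - ⟨-, c1, c2, -⟩
    simp only [BExp.holds, RExp.eval, NExp.eval, nvar, rvar, c1, c2, Nat.cast_lt]
  · rintro K s hK ⟨c1, c2, c3, c4, c5, c6, c7⟩
    refine Halts.seq (Halts.mono (tryCandidate_halts hn0 hq hf hnd hL K s c1 c2) (by gcongr)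
      fun s' ⟨e1, e2, e3⟩ => Halts.setNat ?_)
    set s'' := s'.setNat 2 ((NExp.const 0).eval s') (((nvar 2).add (.const 1)).eval s') with hs''
    have hreal : s''.real = s'.real := rfl
    have ho : output n s'' = output n s' := rfl
    refine ⟨(c1.trans (e1.mono (by omega) le_rfl)).setNat _ _ le_rfl, ?_, ?_, ?_⟩
    · simp [hs'', NExp.eval, nvar, e1.1 2 (by omega), c2]
    · rw [hreal, e2, c3]
    rw [ho, hreal]
    rcases e3 with ⟨k1, k2, k3⟩ | ⟨k1, k2, k3⟩
    · have ho' : output n s' = output n s := by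
        funext i
        rw [output, output, k3]
      rw [ho', k2]
      refine ⟨c4, c5, c6, fun K' hK' => ?_⟩
      rcases Nat.lt_succ_iff_lt_or_eq.1 hK' with h1 | rfl
      · exact c7 K' h1
      · exact k1
    · rw [k2, k3]
      -- An accepted candidate strictly beats a nonnegative record, so `f` is nonzero there and the
      -- new output is a unit vector.
      refine ⟨sum_candidate_sq hd hf K fun h0 => ?_, sq_nonneg _, le_rfl, fun K' hK' => ?_⟩
      · rw [h0] at k1
        norm_num at k1
        linarith
      · rcases Nat.lt_succ_iff_lt_or_eq.1 hK' with h1 | rfl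
        · exact (c7 K' h1).trans k1.le
        · exact le_rfl
  · have h2 : s₁.real 2 0 = 0 := by
      rw [b1.2 2 (by omega)]
      simp [hs₀, inputState]
    have h1 : output n s₁ = output n s₀ := by
      funext i
      rw [output, output, b1.2 1 (by omega)]
    refine ⟨a1, ?_, b2, by rw [h1, hout], h2.ge, by rw [h2]; exact sq_nonneg _, by simp⟩
    rw [b1.1 2 (by omega)]
    simp [hs₀, inputState]

end Search

/-! ### The total running time -/

lemma search_time_le {n d q h m : ℕ} (hn : 2 ≤ n) (hq0 : 0 < q) (hq : q = 2 * h) (hd : d ≤ q)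
    (hm : m ≤ n ^ d) :
    1 + ((3 * h + 2) + ((n + n) ^ h * (((6 * n + 2) + ((h * (3 * (n + n) ^ h + 6) + 3) +
        ((4 * n + 3) + ((3 * n + 2) + ((m * (n * (3 * d + 5) + 6) + 4) + (3 * n + 4)))))) + 1
          + 1) + 1)) ≤ n ^ (16 * q) := by
  set W := n ^ q with hW
  have hnW : n ≤ W := Nat.le_self_pow hq0.ne' n
  have hqW : q < W := Nat.lt_pow_self (by omega)
  have hmW : m ≤ W := hm.trans (Nat.pow_le_pow_right (by omega) hd)
  -- For `n ≥ 2` one has `2 n ≤ n ^ 2`, hence `(2 n) ^ h ≤ n ^ (2 h) = n ^ q`.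
  have hBW : (n + n) ^ h ≤ W := by
    rw [hW, hq, pow_mul]
    exact Nat.pow_le_pow_left (by nlinarith) h
  have hW2 : 2 ≤ W := hn.trans hnW
  have hhW : h ≤ W := by omega
  have hdW : d ≤ W := by omega
  calc _ ≤ 1 + ((3 * W + 2) + (W * (((6 * W + 2) + ((W * (3 * W + 6) + 3) +
        ((4 * W + 3) + ((3 * W + 2) + ((W * (W * (3 * W + 5) + 6) + 4) + (3 * W + 4)))))) + 1
          + 1) + 1)) := by gcongr
    _ = 3 * W ^ 4 + 8 * W ^ 3 + 28 * W ^ 2 + 23 * W + 4 := by ring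
    _ ≤ 66 * W ^ 4 := by
        have h1 : W ^ 3 ≤ W ^ 4 := Nat.pow_le_pow_right (by omega) (by omega)
        have h2 : W ^ 2 ≤ W ^ 4 := Nat.pow_le_pow_right (by omega) (by omega)
        have h3 : W ^ 1 ≤ W ^ 4 := Nat.pow_le_pow_right (by omega) (by omega)
        have h4 : W ^ 0 ≤ W ^ 4 := Nat.pow_le_pow_right (by omega) (by omega)
        rw [pow_one] at h3
        rw [pow_zero] at h4
        omega
    -- The generous `2 ^ 12` is absorbed by `W ^ 12`, as `W ≥ 2`, giving the exponent `16 q`; thus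
    -- 16 serves for both the time and the approximation factor.
    _ ≤ 2 ^ 12 * W ^ 4 := by gcongr; norm_num
    _ ≤ W ^ 12 * W ^ 4 := by gcongr
    _ = n ^ (16 * q) := by rw [← pow_add, hW, ← pow_mul, mul_comm q]

end SphereOpt

theorem mainTheorem7 :
    ∃ (P : RealRAM.Prog) (C : ℕ), ∀ (n d q : ℕ), 0 < d → 0 < q → 2 * d ∣ q → q ≤ n →
      ∀ f : MvPolynomial (Fin n) ℝ, f.IsHomogeneous d →
      ∀ L : List (Fin n →₀ ℕ), L.Nodup → (∀ μ, μ ∈ L ↔ μ ∈ f.support) →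
      ∃ (s : RealRAM.State) (t : ℕ),
        RealRAM.Runs P (SphereOpt.inputState d q f L) s t ∧
        t ≤ n ^ (C * q) ∧
        ∑ i, SphereOpt.output n s i ^ 2 = 1 ∧
        SphereOpt.sphereMax f ≤ SphereOpt.sosMax d q f ∧
        SphereOpt.sosMax d q f ≤
          ENNReal.ofReal ((C : ℝ) ^ d * Real.sqrt (max 1 ((f.support.card : ℝ) / (q : ℝ))) *
            |MvPolynomial.eval (SphereOpt.output n s) f|) := by
  refine ⟨SphereOpt.search, 16, fun n d q hd hq hdq hqn f hf L hnd hL => ?_⟩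
  obtain ⟨r, hr⟩ := hdq
  have hr0 : 0 < r := Nat.pos_of_ne_zero fun h0 => by simp [h0] at hr; omega
  have hqh : q = 2 * (d * r) := by rw [hr, mul_assoc]
  have hdr : d ≤ d * r := Nat.le_mul_of_pos_right d hr0
  obtain ⟨s, t, h1, h2, h3, h4⟩ :=
    SphereOpt.search_halts (n := n) (by omega) hd hqh hf hnd hL
  refine ⟨s, t, h1, h2.trans (SphereOpt.search_time_le (by omega) hq hqh (by omega) ?_), h3, ?_, ?_⟩
  · rw [SphereOpt.length_eq_card_support hnd hL]
    exact SphereOpt.card_support_le_pow hf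
  · refine SphereOpt.sphereMax_le_sosMax hd hq ⟨2 * r, by rw [hr]; ring⟩ f ?_
    rw [hr, show 2 * d * r = d * (2 * r) by ring, Nat.mul_div_cancel_left _ hd]
    exact even_two_mul r
  -- Here `V` is the value of `|f|` at the output, which dominates all candidates and hence all
  -- normalized grid points.
  · refine SphereOpt.sosMax_le hd hr0 hr f hf _ (abs_nonneg _) (fun g b hg hb => ?_) _ (by norm_num)
    obtain ⟨K, hK, hc⟩ := SphereOpt.exists_candidate_eq g b hg hb
    rw [← hc]
    exact sq_le_sq.1 (h4 K hK)
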